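/- **Theorem 4.1 (energetic solvability of the constitutive material relation).** *Setting.* Tensors are real $3\times3$ matrices with contraction product $A{:}B=A_{ij}B_{ij}$ and Frobenius norm $|A|^2=\mathrm{tr}(A^\top A)$. Let $\mathrm{GL}^+=\{\det A>0\}$, $\mathrm{SL}=\{\det A=1\}$, $\mathrm{SO}=\{A\in \mathrm{SL}: A^\top A=I\}$, and let $\mathrm{SL}^+_{\rm sym}$ be the set of symmetric positive-definite $A$ with $\det A=1$, with the topology inherited from $\mathbb R^{3\times 3}$. For a symmetric positive-definite $A$, $A^{1/2}$ is its symmetric positive-definite square root and $A^{-1/2}=(A^{1/2})^{-1}$. Let $W_{\rm e}:\mathrm{GL}^+\to[0,\infty)$ be $C^1$ with $W_{\rm e}(RF)=W_{\rm e}(F)=W_{\rm e}(FR)$ for all $F\in \mathrm{GL}^+$, $R\in \mathrm{SO}$, and let $W_{\rm p}:\mathrm{SL}\to[0,\infty]$ satisfy $W_{\rm p}(RP)=W_{\rm p}(P)$ for all $P\in \mathrm{SL}$, $R\in \mathrm{SO}$. Put $\widehat W_{\rm e}(C_{\rm e})=W_{\rm e}(C_{\rm e}^{1/2})$ for symmetric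 positive-definite $C_{\rm e}$, and $\widehat W_{\rm p}(C_{\rm p})=W_{\rm p}(C_{\rm p}^{1/2})$ for $C_{\rm p}\in \mathrm{SL}^+_{\rm sym}$. Let $T>0$. For a deformation history $t\in[0,T]\mapsto C(t)$ with symmetric positive-definite values, the energy is $$E(C_{\rm p},t)=\widehat W_{\rm e}\big(C_{\rm p}^{-1/2}C(t)C_{\rm p}^{-1/2}\big)+\widehat W_{\rm p}(C_{\rm p})\in[0,\infty].$$ Let $r>0$, let $\widetilde R(A)=\frac r2|A|$ if $\mathrm{tr}\,A=0$ and $\widetilde R(A)=\infty$ otherwise, put $\widehat R(C_{\rm p},\dot C_{\rm p})=\widetilde R(C_{\rm p}^{-1/2}\dot C_{\rm p}C_{\rm p}^{-1/2})$, and let the dissipation metric $D:\mathrm{SL}^+_{\rm sym}\times \mathrm{SL}^+_{\rm sym}\to[0,\infty]$ be $$D(A,B)=\inf\Big\{\int_0^1\widehat R(\gamma(s),\dot\gamma(s))\,ds\ :\ \gamma\in C^1([0,1];\mathrm{SL}^+_{\rm sym}),\ \gamma(0)=A,\ \gamma(1)=B\Big\}.$$ For $t\in[0,T]$ the stable states are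 $$\mathcal S(t)=\{A\in \mathrm{SL}^+_{\rm sym}: E(A,t)<\infty,\ E(A,t)\le E(B,t)+D(A,B)\ \ \forall B\in \mathrm{SL}^+_{\rm sym}\}.$$ For $q:[0,T]\to \mathrm{SL}^+_{\rm sym}$ let $\mathrm{Diss}_{[0,t]}(q)=\sup\sum_{i=1}^N D(q(s_{i-1}),q(s_i))$, the supremum being over all $0=s_0\le s_1\le\dots\le s_N=t$. The *power* $\partial_tE(A,t)$ is the derivative in $t\in[0,T]$ of $E(A,\cdot)$ (one-sided at the end points), where $E(A,\cdot)$ is finite. An *energetic solution* starting from $C_{{\rm p},0}$ is a map $C_{\rm p}:[0,T]\to \mathrm{SL}^+_{\rm sym}$ with $C_{\rm p}(0)=C_{{\rm p},0}$ such that, for all $t\in[0,T]$, $C_{\rm p}(t)\in\mathcal S(t)$, $E(C_{\rm p}(t),\cdot)$ is differentiable at $t$, $\mathrm{Diss}_{[0,t]}(C_{\rm p})<\infty$, the function $s\mapsto\partial_sE(C_{\rm p}(s),s)$ is integrable on $[0,T]$, and $$E(C_{\rm p}(t),t)+\mathrm{Diss}_{[0,t]}(C_{\rm p})=E(C_{\rm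 p}(0),0)+\int_0^t\partial_sE(C_{\rm p}(s),s)\,ds .$$ *Assumptions.* There is $c_2>0$ with $$|F^\top\partial_FW_{\rm e}(F)|\le c_2(1+W_{\rm e}(F))\qquad\forall F\in \mathrm{GL}^+;$$ the sublevels $\{\widehat W_{\rm p}\le\lambda\}$, $\lambda\in\mathbb R$, are compact in $\mathrm{SL}^+_{\rm sym}$; the history $C$ is $C^1$ on $[0,T]$; and $C_{{\rm p},0}\in\mathcal S(0)$. *Conclusion.* 1. There exists an energetic solution starting from $C_{{\rm p},0}$. 2. For every partition $0=t_0<t_1<\dots<t_N=T$ there are $C_{{\rm p},1},\dots,C_{{\rm p},N}\in \mathrm{SL}^+_{\rm sym}$ such that, for $i=1,\dots,N$, $C_{{\rm p},i}$ minimizes $A\mapsto E(A,t_i)+D(C_{{\rm p},i-1},A)$ over $\mathrm{SL}^+_{\rm sym}$. 3. Let partitions $0=t^k_0<\dots<t^k_{N^k}=T$, $k\in\mathbb N$, with $\max_i(t^k_i-t^k_{i-1})\to0$ be given, and for every $k$ any solution $(C_{{\rm p},0},C^k_{{\rm p},1},\dots,C^k_{{\rm p},N^k})$ of the incremental problems of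 part 2. Let $\overline C^k_{\rm p}$ be the backward-constant interpolant, equal to $C^k_{{\rm p},i}$ on $(t^k_{i-1},t^k_i]$ and to $C_{{\rm p},0}$ at $t=0$. Then, for every $k$ and $t\in[0,T]$, $E(\overline C^k_{\rm p}(t),\cdot)$ is finite and differentiable at $t$, and $t\mapsto\partial_tE(\overline C^k_{\rm p}(t),t)$ is integrable on $[0,T]$. Moreover there are a subsequence (not relabeled) and an energetic solution $C_{\rm p}$ starting from $C_{{\rm p},0}$ such that, for all $t\in[0,T]$, $$\overline C^k_{\rm p}(t)\to C_{\rm p}(t),\qquad \mathrm{Diss}_{[0,t]}(\overline C^k_{\rm p})\to\mathrm{Diss}_{[0,t]}(C_{\rm p}),\qquad E(\overline C^k_{\rm p}(t),t)\to E(C_{\rm p}(t),t),$$ and $\partial_tE(\overline C^k_{\rm p}(\cdot),\cdot)\to\partial_tE(C_{\rm p}(\cdot),\cdot)$ in $L^1(0,T)$. -/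

import Mathlib

open Set Filter Topology MeasureTheory
open scoped NNReal ENNReal

noncomputable section

namespace FinitePlasticity

/-- Real `3 × 3` tensors. -/
abbrev Tensor : Type := Matrix (Fin 3) (Fin 3) ℝ

section SquareRoot

open scoped MatrixOrder

/-- The square root `A ^ (1/2)` of a symmetric positive-definite tensor: the unique positive
semidefinite tensor whose square is `A`. -/
def tsqrt (A : Tensor) : Tensor := CFC.sqrt A

theorem tsqrt_mul_self {A : Tensor} (hA : A.PosSemidef) : tsqrt A * tsqrt A = A :=
  CFC.sqrt_mul_sqrt_self A hA.nonneg

theorem tsqrt_posSemidef (A : Tensor) : (tsqrt A).PosSemidef :=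
  Matrix.nonneg_iff_posSemidef.mp (CFC.sqrt_nonneg A)

theorem tsqrt_unique {A S : Tensor} (hS : S.PosSemidef) (h : S * S = A) : tsqrt A = S :=
  CFC.sqrt_unique h hS.nonneg

end SquareRoot

/- From here on tensors carry the Frobenius norm `|A|² = tr (Aᵀ A)`. -/
open scoped Matrix.Norms.Frobenius

/-- The rotations `SO`. -/
def SO : Set Tensor := {Q | Q.transpose * Q = 1 ∧ Q.det = 1}

/-- The tensors `GL⁺` with positive determinant. -/
def GLpos : Set Tensor := {F | 0 < F.det}

/-- The tensors `SL` with determinant one. -/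
def SL : Set Tensor := {P | P.det = 1}

/-- The state space `SL_sym⁺` of symmetric positive-definite tensors with determinant one, with the
topology induced by the tensors. -/
abbrev SLsymPos : Type := {A : Tensor // A.PosDef ∧ A.det = 1}

/-- The tensor `∂_F W (F)` of partial derivatives of a scalar function `W` of a tensor, so that
`dW (F) [H] = ∂_F W (F) : H`. -/
def tensorGrad (W : Tensor → ℝ) (F : Tensor) : Tensor :=
  Matrix.of fun i j => fderiv ℝ W F (Matrix.single i j 1)

section Energy

variable (We : Tensor → ℝ) (Wp : Tensor → ℝ≥0∞)

/-- The elastic energy density as a function of the elastic Cauchy-Green tensor,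
`Ŵ_e (C_e) = W_e (C_e ^ (1/2))`. -/
def WeHat (Ce : Tensor) : ℝ := We (tsqrt Ce)

/-- The plastic energy density as a function of the plastic Cauchy-Green tensor,
`Ŵ_p (C_p) = W_p (C_p ^ (1/2))`. -/
def WpHat (Cp : SLsymPos) : ℝ≥0∞ := Wp (tsqrt Cp.1)

/-- The energy density
`Ŵ (C, C_p) = Ŵ_e (C_p ^ (-1/2) C C_p ^ (-1/2)) + Ŵ_p (C_p)`, with values in `[0, ∞]`
(`W_e` is nonnegative on `GL⁺`). -/
def WHat (C : Tensor) (Cp : SLsymPos) : ℝ≥0∞ :=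
  ENNReal.ofReal (WeHat We ((tsqrt Cp.1)⁻¹ * C * (tsqrt Cp.1)⁻¹)) + WpHat Wp Cp

/-- The complementary energy `E (C_p, t) = Ŵ (C (t), C_p)` for a deformation history `C`. -/
def energy (C : ℝ → Tensor) (Cp : SLsymPos) (t : ℝ) : ℝ≥0∞ := WHat We Wp (C t) Cp

end Energy

section Dissipation

variable (r : ℝ)

/-- `R̃ (A) = (r / 2) |A|` if `tr A = 0`, and `∞` otherwise. -/
def RTilde (A : Tensor) : ℝ≥0∞ :=
  open Classical in if A.trace = 0 then ENNReal.ofReal (r / 2 * ‖A‖) else ⊤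

/-- The infinitesimal dissipation
`R̂ (C_p, Ċ_p) = R̃ (C_p ^ (-1/2) Ċ_p C_p ^ (-1/2))`. -/
def RHat (Cp Cp' : Tensor) : ℝ≥0∞ := RTilde r ((tsqrt Cp)⁻¹ * Cp' * (tsqrt Cp)⁻¹)

/-- `C¹` curves in `SL_sym⁺`, parametrized by `[0, 1]`, from `A` to `B`. -/
structure IsAdmissibleCurve (A B : SLsymPos) (γ : ℝ → Tensor) : Prop where
  contDiffOn : ContDiffOn ℝ 1 γ (Icc 0 1)
  mem : ∀ s ∈ Icc (0 : ℝ) 1, (γ s).PosDef ∧ (γ s).det = 1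
  start : γ 0 = A.1
  finish : γ 1 = B.1

/-- The dissipation metric: the infimum of `∫₀¹ R̂ (γ, γ̇) ds` over the `C¹` curves `γ` in `SL_sym⁺`
from `A` to `B`. -/
def dissip (A B : SLsymPos) : ℝ≥0∞ :=
  ⨅ (γ : ℝ → Tensor) (_ : IsAdmissibleCurve A B γ),
    ∫⁻ s in Icc (0 : ℝ) 1, RHat r (γ s) (derivWithin γ (Icc 0 1) s)

end Dissipation

section Energetic

variable {Q : Type*} (T : ℝ) (E : Q → ℝ → ℝ≥0∞) (D : Q → Q → ℝ≥0∞)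

/-- The set `S (t)` of stable states at time `t`. -/
def stableStates (t : ℝ) : Set Q := {q | E q t < ⊤ ∧ ∀ q' : Q, E q t ≤ E q' t + D q q'}

/-- The total dissipation of `q` on `[0, t]`: the supremum of `∑ D (q (s_{i-1}), q (s_i))` over all
partitions `0 = s_0 ≤ s_1 ≤ … ≤ s_N = t`. -/
def totalDiss (q : ℝ → Q) (t : ℝ) : ℝ≥0∞ :=
  ⨆ (p : ℕ × {s : ℕ → ℝ // Monotone s}) (_ : p.2.1 0 = 0 ∧ p.2.1 p.1 = t),
    ∑ i ∈ Finset.range p.1, D (q (p.2.1 i)) (q (p.2.1 (i + 1)))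

/-- The energy `E (q, ·)` is finite at time `t` and differentiable there, as a function on
`[0, T]`. -/
def HasPowerAt (q : Q) (t : ℝ) : Prop :=
  E q t < ⊤ ∧ DifferentiableWithinAt ℝ (fun s => (E q s).toReal) (Icc 0 T) t

/-- The power `∂_t E (q, t)`, for `t` in `[0, T]` (one-sided at the two end points). -/
def power (q : Q) (t : ℝ) : ℝ := derivWithin (fun s => (E q s).toReal) (Icc 0 T) t

/-- `q : [0, T] → Q` is an energetic solution corresponding to `(Q, E, D)` and starting from `q₀`:
the initial condition, global stability and the energy balance hold, and all the terms of the
balance are well defined and finite. -/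
structure IsEnergeticSolution (q₀ : Q) (q : ℝ → Q) : Prop where
  initial : q 0 = q₀
  stable : ∀ t ∈ Icc 0 T, q t ∈ stableStates E D t
  hasPower : ∀ t ∈ Icc 0 T, HasPowerAt T E (q t) t
  integrable : IntegrableOn (fun t => power T E (q t) t) (Icc 0 T)
  diss_finite : ∀ t ∈ Icc 0 T, totalDiss D q t < ⊤
  balance : ∀ t ∈ Icc 0 T, (E (q t) t).toReal + (totalDiss D q t).toReal =
    (E (q 0) 0).toReal + ∫ s in (0 : ℝ)..t, power T E (q s) s

/-- A partition `0 = t_0 < t_1 < … < t_N = T` of `[0, T]` (only the values `node i` with `i ≤ num`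
matter). -/
structure TimePartition where
  num : ℕ
  node : ℕ → ℝ
  node_zero : node 0 = 0
  node_num : node num = T
  node_lt : ∀ i < num, node i < node (i + 1)

/-- The time step `max (t_i - t_{i-1})`. -/
def TimePartition.step {T : ℝ} (P : TimePartition T) : ℝ :=
  ⨆ i : Fin P.num, (P.node (i + 1) - P.node i)

/-- `c 0 = q₀` and, for `i = 1, …, N`, `c i` minimizes `q ↦ E (q, t_i) + D (c (i-1), q)` over `Q`. -/
def IsIncrementalSolution {T : ℝ} (P : TimePartition T) (q₀ : Q) (c : ℕ → Q) : Prop :=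
  c 0 = q₀ ∧ ∀ i < P.num, ∀ q : Q,
    E (c (i + 1)) (P.node (i + 1)) + D (c i) (c (i + 1)) ≤ E q (P.node (i + 1)) + D (c i) q

/-- The piecewise backward-constant interpolant of `c` on the partition `P`: it takes the value
`c i` on `(t_{i-1}, t_i]`, and `c 0` at time `0`. -/
def interpolant {T : ℝ} (P : TimePartition T) (c : ℕ → Q) (t : ℝ) : Q :=
  c (sInf {i : ℕ | t ≤ P.node i})

end Energetic

end FinitePlasticity

end

open FinitePlasticity
open scoped Matrix.Norms.Frobenius

namespace FinitePlasticity

/-! ### Square roots of positive-definite tensors -/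

/-! The theorem is an instance of an abstract existence theory for rate-independent systems.
`IsEnergeticSystem` collects what that theory uses: the energy is `e + w` with `e` jointly
continuous and having a jointly continuous power `p`, `|p| ≤ c (1 + e)`, the time-independent part
`w` has compact sublevels, and `D` is finite, continuous, definite and satisfies the triangle
inequality.

Tensor side. Differentiating the square root of `C_p^{-1/2} C C_p^{-1/2}` in time is avoided: by
isotropy and polar decomposition the elastic energy equals `W_e (C_p^{-1/2} C^{1/2})`
(`WeHat_conj`), where only `C^{1/2}` depends on time, and it is `C¹` by the inverse function theorem
(`contDiffWithinAt_tsqrt_comp`). Its velocity is the strain times a bounded function of time, so the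
Kirchhoff stress bound is exactly the growth condition on the power. The metric is bounded below by
differences of `log tr (Mᵀ C_p M)`, which gives definiteness (`ofReal_abs_log_le_dissip`), and above
by the length of an explicit exponential curve (`dissip_le_sqrt_trace`), which gives finiteness and,
with the triangle inequality, continuity.

Abstract side. Testing minimality with the previous state and using Gronwall keeps all incremental
solutions in one compact set, on which the power is bounded. Dissipations are then bounded, and
Helly's principle extracts a pointwise limit `v` of the interpolants and a limit `g` of their
dissipations (`exists_isConvergent`). Stability passes to the limit because `D` is continuous, and
testing it with the limit yields convergence of `w` (`stable_and_tendsto`). The discrete energy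
inequality gives `E + g ≤ E₀ + ∫ p` (`energy_upper_estimate`); stability of `v` alone gives `E₀ + ∫
p ≤ E + Diss` (`energy_lower_estimate`). As `Diss ≤ g`, all are equalities: the balance holds and
the dissipations converge to that of `v`. -/

instance : TopologicalSpace.MetrizableSpace Tensor :=
  inferInstanceAs (TopologicalSpace.MetrizableSpace (Fin 3 → Fin 3 → ℝ))

instance : TopologicalSpace.MetrizableSpace SLsymPos :=
  Topology.IsEmbedding.subtypeVal.metrizableSpace

instance : FirstCountableTopology Tensor :=
  inferInstanceAs (FirstCountableTopology (Fin 3 → Fin 3 → ℝ))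

theorem tensor_norm_sq (A : Tensor) : ‖A‖ ^ 2 = (A.transpose * A).trace := by
  rw [Matrix.frobenius_norm_def, ← Real.sqrt_eq_rpow, Real.sq_sqrt (by positivity)]
  simp only [Real.norm_eq_abs, Real.rpow_ofNat, sq_abs, Matrix.trace, Matrix.diag,
    Matrix.mul_apply, Matrix.transpose_apply]
  rw [Finset.sum_comm]
  simp only [sq]

theorem tsqrt_transpose (A : Tensor) : (tsqrt A).transpose = tsqrt A := by
  have := (tsqrt_posSemidef A).1
  rwa [Matrix.IsHermitian, Matrix.conjTranspose_eq_transpose_of_trivial] at this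

theorem _root_.Matrix.PosDef.transpose_eq {A : Tensor} (hA : A.PosDef) : A.transpose = A := by
  have := hA.1
  rwa [Matrix.IsHermitian, Matrix.conjTranspose_eq_transpose_of_trivial] at this

theorem tsqrt_posDef {A : Tensor} (hA : A.PosDef) : (tsqrt A).PosDef := by
  refine (tsqrt_posSemidef A).posDef_iff_isUnit.2 ?_
  have h := tsqrt_mul_self hA.posSemidef
  have hu : IsUnit (tsqrt A * tsqrt A) := by rw [h]; exact hA.isUnit
  exact isUnit_of_mul_isUnit_left hu

theorem det_tsqrt_pos {A : Tensor} (hA : A.PosDef) : 0 < (tsqrt A).det := (tsqrt_posDef hA).det_pos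

theorem tsqrt_mul_inv {A : Tensor} (hA : A.PosDef) : tsqrt A * (tsqrt A)⁻¹ = 1 :=
  Matrix.mul_nonsing_inv _ (det_tsqrt_pos hA).ne'.isUnit

theorem tsqrt_inv_mul {A : Tensor} (hA : A.PosDef) : (tsqrt A)⁻¹ * tsqrt A = 1 :=
  Matrix.nonsing_inv_mul _ (det_tsqrt_pos hA).ne'.isUnit

theorem norm_tsqrt_sq {A : Tensor} (hA : A.PosSemidef) : ‖tsqrt A‖ ^ 2 = A.trace := by
  rw [tensor_norm_sq, tsqrt_transpose, tsqrt_mul_self hA]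

theorem isClosed_posSemidef : IsClosed {A : Tensor | A.PosSemidef} := by
  have : {A : Tensor | A.PosSemidef} = {A : Tensor | A.conjTranspose = A} ∩
      ⋂ x : Fin 3 → ℝ, {A : Tensor | 0 ≤ star x ⬝ᵥ A.mulVec x} := by
    ext A
    simp [Matrix.posSemidef_iff_dotProduct_mulVec, Matrix.IsHermitian]
  rw [this]
  refine (isClosed_eq (by fun_prop) continuous_id).inter (isClosed_iInter fun x => ?_)
  exact isClosed_le continuous_const (by fun_prop)

/-- Compactness and uniqueness: `|A^{1/2}|² = tr A` keeps the roots of a convergent sequence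
bounded, and any cluster point is positive semidefinite with square `A`. -/
theorem continuousOn_tsqrt : ContinuousOn tsqrt {A : Tensor | A.PosSemidef} := by
  intro A hA
  refine tendsto_of_seq_tendsto fun u hu => ?_
  rw [tendsto_nhdsWithin_iff] at hu
  obtain ⟨hu, hmem⟩ := hu
  refine tendsto_of_subseq_tendsto fun ns hns => ?_
  have hun : Tendsto (fun n => u (ns n)) atTop (𝓝 A) := hu.comp hns
  have hpsd : ∀ᶠ n in atTop, (u (ns n)).PosSemidef := hns.eventually hmem
  have htr : Tendsto (fun n => (u (ns n)).trace) atTop (𝓝 A.trace) :=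
    (continuous_id.matrix_trace.tendsto A).comp hun
  have hbd : ∀ᶠ n in atTop, tsqrt (u (ns n)) ∈ Metric.closedBall (0 : Tensor) (A.trace + 2) := by
    filter_upwards [hpsd, htr.eventually (gt_mem_nhds (lt_add_one A.trace))] with n h1 h2
    rw [mem_closedBall_zero_iff]
    have h3 := norm_tsqrt_sq h1
    have h4 : 0 ≤ A.trace := hA.trace_nonneg
    nlinarith [norm_nonneg (tsqrt (u (ns n)))]
  obtain ⟨S, -, φ, hφ, hS⟩ := (isCompact_closedBall (0 : Tensor) (A.trace + 2)).tendsto_subseq'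
    hbd.frequently
  refine ⟨φ, ?_⟩
  have hSpsd : S.PosSemidef :=
    isClosed_posSemidef.mem_of_tendsto hS (Eventually.of_forall fun n => tsqrt_posSemidef _)
  have hSS : S * S = A := by
    refine tendsto_nhds_unique (hS.mul hS) ?_
    refine (hun.comp hφ.tendsto_atTop).congr' ?_
    filter_upwards [hφ.tendsto_atTop.eventually hpsd] with n hn
    exact (tsqrt_mul_self hn).symm
  rw [tsqrt_unique hSpsd hSS]
  exact hS

theorem continuous_tsqrt_SLsymPos : Continuous fun A : SLsymPos => tsqrt A.1 :=
  continuousOn_tsqrt.comp_continuous continuous_subtype_val fun A => A.2.1.posSemidef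

theorem continuousAt_tensor_inv {A : Tensor} (h : A.det ≠ 0) :
    ContinuousAt (fun B : Tensor => B⁻¹) A := by
  have : (fun B : Tensor => B⁻¹) = fun B => Ring.inverse B.det • B.adjugate := by
    ext1 B; rw [Matrix.inv_def]
  rw [this]
  have h1 : ContinuousAt (fun B : Tensor => Ring.inverse B.det) A := by
    simp only [Ring.inverse_eq_inv']
    exact (continuous_id.matrix_det.continuousAt).inv₀ h
  exact h1.smul continuous_id.matrix_adjugate.continuousAt

theorem continuous_tsqrt_inv_SLsymPos : Continuous fun A : SLsymPos => (tsqrt A.1)⁻¹ := by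
  refine continuous_iff_continuousAt.2 fun A => ?_
  exact (continuousAt_tensor_inv (det_tsqrt_pos A.2.1).ne').comp
    (f := fun A : SLsymPos => tsqrt A.1) continuous_tsqrt_SLsymPos.continuousAt

/-- The linear map `H ↦ H S + S H`, the derivative of `S ↦ S * S`. -/
noncomputable def sylvester (S : Tensor) : Tensor →L[ℝ] Tensor :=
  LinearMap.toContinuousLinearMap
    (LinearMap.mulRight ℝ S + LinearMap.mulLeft ℝ S : Tensor →ₗ[ℝ] Tensor)

theorem sylvester_apply (S H : Tensor) : sylvester S H = H * S + S * H := rfl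

theorem trace_conj_nonneg {S : Tensor} (hS : S.PosSemidef) (H : Tensor) :
    0 ≤ (H.transpose * S * H).trace := by
  have := (hS.conjTranspose_mul_mul_same H).trace_nonneg
  rwa [Matrix.conjTranspose_eq_transpose_of_trivial] at this

theorem eq_zero_of_trace_conj {S : Tensor} (hS : S.PosDef) {H : Tensor}
    (h : (H.transpose * S * H).trace = 0) : H = 0 := by
  have h1 : ‖tsqrt S * H‖ ^ 2 = 0 := by
    rw [tensor_norm_sq, Matrix.transpose_mul, tsqrt_transpose, ← h, Matrix.mul_assoc,
      ← Matrix.mul_assoc (tsqrt S), tsqrt_mul_self hS.posSemidef, Matrix.mul_assoc]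
  have h2 : tsqrt S * H = 0 := by simpa using h1
  calc H = (tsqrt S)⁻¹ * (tsqrt S * H) := by
        rw [← Matrix.mul_assoc, tsqrt_inv_mul hS, Matrix.one_mul]
    _ = 0 := by rw [h2, Matrix.mul_zero]

/-- Pairing `H S + S H = 0` with `H` gives a sum of two nonnegative traces, so `tr (Hᵀ S H) = 0`. -/
theorem sylvester_injective {S : Tensor} (hS : S.PosDef) : Function.Injective (sylvester S) := by
  refine (injective_iff_map_eq_zero _).2 fun H hH => ?_
  rw [sylvester_apply] at hH
  have h0 : (H.transpose * (H * S + S * H)).trace = 0 := by rw [hH]; simp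
  rw [Matrix.mul_add, Matrix.trace_add] at h0
  have h1 := trace_conj_nonneg hS.posSemidef H.transpose
  have h2 := trace_conj_nonneg hS.posSemidef H
  rw [Matrix.transpose_transpose] at h1
  have h3 : (H.transpose * (H * S)).trace = (H * S * H.transpose).trace := by
    rw [Matrix.trace_mul_comm]
  rw [h3, ← Matrix.mul_assoc H.transpose S H] at h0
  exact eq_zero_of_trace_conj hS (by linarith)

/-- The squaring map has an invertible derivative at `C (t)^{1/2}`. Continuity of the root keeps
`C^{1/2}` in the neighbourhood where the `C¹` local inverse of squaring is its inverse. -/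
theorem contDiffWithinAt_tsqrt_comp {C : ℝ → Tensor} {s : Set ℝ} {t : ℝ}
    (hC : ContDiffOn ℝ 1 C s) (hpos : ∀ t ∈ s, (C t).PosDef) (ht : t ∈ s) :
    ContDiffWithinAt ℝ 1 (fun t => tsqrt (C t)) s t := by
  set S : Tensor := tsqrt (C t) with hSdef
  have hS : S.PosDef := tsqrt_posDef (hpos t ht)
  let f' : Tensor ≃L[ℝ] Tensor := ContinuousLinearEquiv.ofBijective (sylvester S)
    (LinearMap.ker_eq_bot.2 (sylvester_injective hS))
    (LinearMap.range_eq_top.2 (LinearMap.injective_iff_surjective.1 (sylvester_injective hS)))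
  have hcd : ContDiff ℝ 1 (fun X : Tensor => X * X) := contDiff_id.mul contDiff_id
  have hd : HasFDerivAt (fun X : Tensor => X * X) (f' : Tensor →L[ℝ] Tensor) S := by
    have := (hasFDerivAt_id (𝕜 := ℝ) S).mul' (hasFDerivAt_id (𝕜 := ℝ) S)
    refine this.congr_fderiv ?_
    ext1 H
    change S * H + H * S = sylvester S H
    rw [sylvester_apply, add_comm]
  have hstrict := hcd.contDiffAt.hasStrictFDerivAt' (x := S) hd (by norm_num)
  have hg := ContDiffAt.to_localInverse (hcd.contDiffAt (x := S)) hd (by norm_num)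
  have hSS : S * S = C t := tsqrt_mul_self (hpos t ht).posSemidef
  have hcont : ContinuousWithinAt (fun t => tsqrt (C t)) s t :=
    (continuousOn_tsqrt.comp hC.continuousOn fun x hx => (hpos x hx).posSemidef) t ht
  have hev : ∀ᶠ x in 𝓝[s] t, hstrict.localInverse _ _ _ (C x) = tsqrt (C x) := by
    filter_upwards [hcont.eventually hstrict.eventually_left_inverse, self_mem_nhdsWithin]
      with x hx hxs
    rw [← hx, tsqrt_mul_self (hpos x hxs).posSemidef]
  have hg' : ContDiffAt ℝ 1 (hstrict.localInverse _ _ _) (C t) := by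
    rw [← hSS]; exact hg
  refine ((hg'.comp_contDiffWithinAt t (hC t ht))).congr_of_eventuallyEq ?_ ?_
  · filter_upwards [hev] with x hx using hx.symm
  · exact (hev.self_of_nhdsWithin ht).symm

/-- By isotropy the elastic energy of `C ^ (1/2)` conjugated by `M` is that of `M C ^ (1/2)`. -/
theorem WeHat_conj {We : Tensor → ℝ}
    (hWe_iso : ∀ F ∈ GLpos, ∀ R ∈ SO, We (F * R) = We F)
    {M C : Tensor} (hM : M.transpose = M) (hMdet : 0 < M.det) (hC : C.PosDef) :
    WeHat We (M * C * M) = We (M * tsqrt C) := by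
  set F := M * tsqrt C with hF
  have hFdet : 0 < F.det := by
    rw [hF, Matrix.det_mul]; exact mul_pos hMdet (det_tsqrt_pos hC)
  have hFF : F * F.transpose = M * C * M := by
    rw [hF, Matrix.transpose_mul, tsqrt_transpose, hM, Matrix.mul_assoc, ← Matrix.mul_assoc (tsqrt C),
      tsqrt_mul_self hC.posSemidef, Matrix.mul_assoc]
  have hpos : (M * C * M).PosDef := by
    have : IsUnit M := (Matrix.isUnit_iff_isUnit_det M).2 hMdet.ne'.isUnit
    have h := hC.conjTranspose_mul_mul_same (B := M) (Matrix.mulVec_injective_iff_isUnit.2 this)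
    rwa [Matrix.conjTranspose_eq_transpose_of_trivial, hM] at h
  set V := tsqrt (M * C * M) with hV
  have hVdet : 0 < V.det := det_tsqrt_pos hpos
  have hVV : V * V = F * F.transpose := by rw [hFF]; exact tsqrt_mul_self hpos.posSemidef
  have hVT : V⁻¹.transpose = V⁻¹ := by
    rw [Matrix.transpose_nonsing_inv, hV, tsqrt_transpose]
  have h1 : V * V⁻¹ = 1 := tsqrt_mul_inv hpos
  have h2 : V⁻¹ * V = 1 := tsqrt_inv_mul hpos
  -- The rotation in the polar decomposition `F = V R`, with `V` the root of `F Fᵀ`; isotropy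
  -- removes it on the right.
  have hR : V⁻¹ * F ∈ SO := by
    have hRR : (V⁻¹ * F) * (V⁻¹ * F).transpose = 1 := by
      rw [Matrix.transpose_mul, hVT]
      calc V⁻¹ * F * (F.transpose * V⁻¹) = V⁻¹ * (F * F.transpose) * V⁻¹ := by
            simp only [Matrix.mul_assoc]
        _ = (V⁻¹ * V) * (V * V⁻¹) := by rw [← hVV]; simp only [Matrix.mul_assoc]
        _ = 1 := by rw [h1, h2, Matrix.one_mul]
    refine ⟨mul_eq_one_comm.1 hRR, ?_⟩
    have hdet := congrArg Matrix.det hRR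
    rw [Matrix.det_mul, Matrix.det_transpose, Matrix.det_one] at hdet
    have hp : 0 < (V⁻¹ * F).det := by
      rw [Matrix.det_mul, Matrix.det_nonsing_inv, Ring.inverse_eq_inv']
      positivity
    nlinarith
  have := hWe_iso V hVdet _ hR
  rw [← Matrix.mul_assoc, h1, Matrix.one_mul] at this
  rw [WeHat, ← hV, this]

/-! ### The elastic energy along the deformation history -/

theorem abs_trace_transpose_mul_le (A B : Tensor) : |(A.transpose * B).trace| ≤ ‖A‖ * ‖B‖ := by
  refine abs_le_of_sq_le_sq ?_ (by positivity)
  rw [mul_pow, tensor_norm_sq, tensor_norm_sq]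
  simp only [Matrix.trace, Matrix.diag, Matrix.mul_apply, Matrix.transpose_apply,
    ← Finset.sum_product']
  have := Finset.sum_mul_sq_le_sq_mul_sq (Finset.univ ×ˢ Finset.univ : Finset (Fin 3 × Fin 3))
    (fun x => A x.2 x.1) (fun x => B x.2 x.1)
  simpa only [sq] using this

theorem fderiv_apply_eq_trace (W : Tensor → ℝ) (F H : Tensor) :
    fderiv ℝ W F H = ((tensorGrad W F).transpose * H).trace := by
  conv_lhs => rw [Matrix.matrix_eq_sum_single H]
  simp only [map_sum, Matrix.trace, Matrix.diag, Matrix.mul_apply, Matrix.transpose_apply,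
    tensorGrad, Matrix.of_apply]
  rw [Finset.sum_comm]
  refine Finset.sum_congr rfl fun i _ => Finset.sum_congr rfl fun j _ => ?_
  have : Matrix.single j i (H j i) = H j i • (Matrix.single j i 1 : Tensor) := by
    rw [Matrix.smul_single, smul_eq_mul, mul_one]
  rw [this, map_smul, smul_eq_mul, mul_comm]

/-- For a direction `F H`, the factor `F` moves onto the gradient, producing the stress `Fᵀ ∂_F W`
that the growth hypothesis controls. -/
theorem abs_fderiv_mul_le (W : Tensor → ℝ) (F H : Tensor) :
    |fderiv ℝ W F (F * H)| ≤ ‖F.transpose * tensorGrad W F‖ * ‖H‖ := by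
  rw [fderiv_apply_eq_trace, ← Matrix.mul_assoc]
  have : (tensorGrad W F).transpose * F = (F.transpose * tensorGrad W F).transpose := by
    rw [Matrix.transpose_mul, Matrix.transpose_transpose]
  rw [this]
  exact abs_trace_transpose_mul_le _ _

theorem isOpen_GLpos : IsOpen GLpos :=
  isOpen_lt continuous_const continuous_id.matrix_det

section History

variable (We : Tensor → ℝ) (C : ℝ → Tensor) {T : ℝ} (hT : 0 ≤ T)

/-- The stretch `C ^ (1/2)` of the deformation history. -/
noncomputable def stretch (t : ℝ) : Tensor := tsqrt (C t)

/-- The elastic energy as a function of state and time, extended constantly beyond `[0, T]`. -/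
noncomputable def elasticEnergy (A : SLsymPos) (t : ℝ) : ℝ :=
  We ((tsqrt A.1)⁻¹ * stretch C (projIcc 0 T hT t))

/-- The time derivative of the elastic energy, extended constantly beyond `[0, T]`. -/
noncomputable def elasticPower (A : SLsymPos) (t : ℝ) : ℝ :=
  fderiv ℝ We ((tsqrt A.1)⁻¹ * stretch C (projIcc 0 T hT t))
    ((tsqrt A.1)⁻¹ * derivWithin (stretch C) (Icc 0 T) (projIcc 0 T hT t))

variable {We C}

theorem det_tsqrt_inv_pos {A : Tensor} (hA : A.PosDef) : 0 < (tsqrt A)⁻¹.det := by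
  rw [Matrix.det_nonsing_inv, Ring.inverse_eq_inv']
  exact inv_pos.2 (det_tsqrt_pos hA)

theorem inv_tsqrt_mul_stretch_mem (A : SLsymPos) {t : ℝ} (ht : (C t).PosDef) :
    (tsqrt A.1)⁻¹ * stretch C t ∈ GLpos := by
  rw [GLpos, mem_ofPred_eq]
  rw [Matrix.det_mul]
  exact mul_pos (det_tsqrt_inv_pos A.2.1) (det_tsqrt_pos ht)

theorem contDiffOn_stretch (hC_pos : ∀ t ∈ Icc 0 T, (C t).PosDef)
    (hC_smooth : ContDiffOn ℝ 1 C (Icc 0 T)) : ContDiffOn ℝ 1 (stretch C) (Icc 0 T) :=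
  fun _ ht => contDiffWithinAt_tsqrt_comp hC_smooth hC_pos ht

theorem elasticEnergy_nonneg (hWe_nonneg : ∀ F ∈ GLpos, 0 ≤ We F)
    (hC_pos : ∀ t ∈ Icc 0 T, (C t).PosDef) (A : SLsymPos) (t : ℝ) :
    0 ≤ elasticEnergy We C hT A t :=
  hWe_nonneg _ (inv_tsqrt_mul_stretch_mem A (hC_pos _ (projIcc 0 T hT t).2))

theorem continuous_elasticStrain (hC_pos : ∀ t ∈ Icc 0 T, (C t).PosDef)
    (hC_smooth : ContDiffOn ℝ 1 C (Icc 0 T)) :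
    Continuous fun x : SLsymPos × ℝ => (tsqrt x.1.1)⁻¹ * stretch C (projIcc 0 T hT x.2) := by
  have h1 : Continuous fun t : ℝ => stretch C (projIcc 0 T hT t) :=
    (contDiffOn_stretch hC_pos hC_smooth).continuousOn.comp_continuous
      (continuous_subtype_val.comp continuous_projIcc) fun t => (projIcc 0 T hT t).2
  exact (continuous_tsqrt_inv_SLsymPos.comp continuous_fst).mul (h1.comp continuous_snd)

theorem continuous_elasticEnergy (hWe_smooth : ContDiffOn ℝ 1 We GLpos)
    (hC_pos : ∀ t ∈ Icc 0 T, (C t).PosDef) (hC_smooth : ContDiffOn ℝ 1 C (Icc 0 T)) :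
    Continuous (Function.uncurry (elasticEnergy We C hT)) :=
  hWe_smooth.continuousOn.comp_continuous (continuous_elasticStrain hT hC_pos hC_smooth)
    fun x => inv_tsqrt_mul_stretch_mem x.1 (hC_pos _ (projIcc 0 T hT x.2).2)

theorem continuous_elasticPower (hT' : 0 < T) (hWe_smooth : ContDiffOn ℝ 1 We GLpos)
    (hC_pos : ∀ t ∈ Icc 0 T, (C t).PosDef) (hC_smooth : ContDiffOn ℝ 1 C (Icc 0 T)) :
    Continuous (Function.uncurry (elasticPower We C hT)) := by
  have h1 : Continuous fun x : SLsymPos × ℝ =>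
      fderiv ℝ We ((tsqrt x.1.1)⁻¹ * stretch C (projIcc 0 T hT x.2)) :=
    (hWe_smooth.continuousOn_fderiv_of_isOpen isOpen_GLpos le_rfl).comp_continuous
      (continuous_elasticStrain hT hC_pos hC_smooth)
      fun x => inv_tsqrt_mul_stretch_mem x.1 (hC_pos _ (projIcc 0 T hT x.2).2)
  have h2 : Continuous fun t : ℝ => derivWithin (stretch C) (Icc 0 T) (projIcc 0 T hT t) :=
    ((contDiffOn_stretch hC_pos hC_smooth).continuousOn_derivWithin (uniqueDiffOn_Icc hT')
      le_rfl).comp_continuous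
      (continuous_subtype_val.comp continuous_projIcc) fun t => (projIcc 0 T hT t).2
  exact h1.clm_apply
    ((continuous_tsqrt_inv_SLsymPos.comp continuous_fst).mul (h2.comp continuous_snd))

theorem hasDerivWithinAt_elasticEnergy (hWe_smooth : ContDiffOn ℝ 1 We GLpos)
    (hC_pos : ∀ t ∈ Icc 0 T, (C t).PosDef) (hC_smooth : ContDiffOn ℝ 1 C (Icc 0 T))
    (A : SLsymPos) {t : ℝ} (ht : t ∈ Icc 0 T) :
    HasDerivWithinAt (elasticEnergy We C hT A) (elasticPower We C hT A t) (Icc 0 T) t := by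
  have hp : ∀ s ∈ Icc 0 T, (projIcc 0 T hT s : ℝ) = s := fun s hs => by
    rw [projIcc_of_mem hT hs]
  have hW : HasFDerivAt We (fderiv ℝ We ((tsqrt A.1)⁻¹ * stretch C t))
      ((tsqrt A.1)⁻¹ * stretch C t) :=
    ((hWe_smooth.contDiffAt (isOpen_GLpos.mem_nhds
      (inv_tsqrt_mul_stretch_mem A (hC_pos t ht)))).differentiableAt (by norm_num)).hasFDerivAt
  have hG : HasDerivWithinAt (stretch C) (derivWithin (stretch C) (Icc 0 T) t) (Icc 0 T) t :=
    ((contDiffOn_stretch hC_pos hC_smooth).differentiableOn (by norm_num) t ht).hasDerivWithinAt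
  have hMG := hG.const_mul ((tsqrt A.1)⁻¹)
  have := hW.comp_hasDerivWithinAt t hMG
  unfold elasticPower
  rw [hp t ht]
  refine this.congr (fun s hs => ?_) ?_
  · simp only [elasticEnergy, hp s hs, Function.comp]
  · simp only [elasticEnergy, hp t ht, Function.comp]

/-- With `G = C^{1/2}` and `F = C_p^{-1/2} G`, the velocity of the strain is `F (G⁻¹ Ġ)`. The second
factor does not involve the state and is bounded on `[0, T]`, so the constant is uniform in `C_p`.
-/
theorem exists_abs_elasticPower_le (hT' : 0 < T) {c₂ : ℝ}
    (hKirchhoff : ∀ F ∈ GLpos, ‖F.transpose * tensorGrad We F‖ ≤ c₂ * (1 + We F))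
    (hC_pos : ∀ t ∈ Icc 0 T, (C t).PosDef) (hC_smooth : ContDiffOn ℝ 1 C (Icc 0 T)) :
    ∃ c : ℝ, ∀ A t, |elasticPower We C hT A t| ≤ c * (1 + elasticEnergy We C hT A t) := by
  have h1 : ContinuousOn (fun t => (stretch C t)⁻¹ * derivWithin (stretch C) (Icc 0 T) t)
      (Icc 0 T) := by
    refine ContinuousOn.mul (fun t ht => ?_)
      ((contDiffOn_stretch hC_pos hC_smooth).continuousOn_derivWithin (uniqueDiffOn_Icc hT') le_rfl)
    exact (continuousAt_tensor_inv (det_tsqrt_pos (hC_pos t ht)).ne').comp_continuousWithinAt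
      (f := stretch C) ((contDiffOn_stretch hC_pos hC_smooth).continuousOn t ht)
  obtain ⟨K, hK⟩ := isCompact_Icc.exists_bound_of_continuousOn h1
  refine ⟨c₂ * K, fun A t => ?_⟩
  obtain ⟨τ, hτ⟩ : ∃ τ : ℝ, τ = (projIcc 0 T hT t : ℝ) := ⟨_, rfl⟩
  have hτm : τ ∈ Icc 0 T := hτ ▸ (projIcc 0 T hT t).2
  have hmem := inv_tsqrt_mul_stretch_mem A (hC_pos τ hτm)
  have heq : (tsqrt A.1)⁻¹ * derivWithin (stretch C) (Icc 0 T) τ =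
      ((tsqrt A.1)⁻¹ * stretch C τ) *
        ((stretch C τ)⁻¹ * derivWithin (stretch C) (Icc 0 T) τ) := by
    rw [Matrix.mul_assoc, ← Matrix.mul_assoc (stretch C τ), stretch, tsqrt_mul_inv (hC_pos τ hτm),
      Matrix.one_mul]
  unfold elasticPower elasticEnergy
  rw [← hτ, heq]
  refine (abs_fderiv_mul_le _ _ _).trans ?_
  have hK0 : 0 ≤ K := (norm_nonneg _).trans (hK τ hτm)
  have h2 := mul_le_mul (hKirchhoff _ hmem) (hK τ hτm) (norm_nonneg _)
    ((norm_nonneg _).trans (hKirchhoff _ hmem))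
  linarith

theorem energy_eq (hWe_iso : ∀ F ∈ GLpos, ∀ R ∈ SO, We (F * R) = We F) (Wp : Tensor → ℝ≥0∞)
    (hC_pos : ∀ t ∈ Icc 0 T, (C t).PosDef) (A : SLsymPos) {t : ℝ} (ht : t ∈ Icc 0 T) :
    energy We Wp C A t = ENNReal.ofReal (elasticEnergy We C hT A t) + WpHat Wp A := by
  have hM : (tsqrt A.1)⁻¹.transpose = (tsqrt A.1)⁻¹ := by
    rw [Matrix.transpose_nonsing_inv, tsqrt_transpose]
  rw [energy, WHat, WeHat_conj hWe_iso hM (det_tsqrt_inv_pos A.2.1) (hC_pos t ht), elasticEnergy,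
    projIcc_of_mem hT ht, stretch]

end History

/-! ### The dissipation metric -/

section Dissipation

variable {r : ℝ}

theorem RTilde_smul {a : ℝ} (ha : 0 ≤ a) (A : Tensor) :
    RTilde r (a • A) = ENNReal.ofReal a * RTilde r A := by
  -- At `a = 0` both sides vanish even where `RTilde` is infinite, by `0 * ∞ = 0`.
  rcases ha.eq_or_lt with rfl | ha
  · simp [RTilde]
  unfold RTilde
  by_cases h : A.trace = 0
  · rw [if_pos h, if_pos (by rw [Matrix.trace_smul, h, smul_zero]), ← ENNReal.ofReal_mul ha.le,
      norm_smul, Real.norm_of_nonneg ha.le]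
    congr 1; ring
  · rw [if_neg h, if_neg (by rw [Matrix.trace_smul, smul_eq_mul]; exact mul_ne_zero ha.ne' h),
      ENNReal.mul_top (by simpa using ha)]

theorem RHat_smul {a : ℝ} (ha : 0 ≤ a) (A H : Tensor) :
    RHat r A (a • H) = ENNReal.ofReal a * RHat r A H := by
  rw [RHat, Matrix.mul_smul, Matrix.smul_mul, RTilde_smul ha, RHat]

theorem ofReal_norm_le_RHat (A H : Tensor) :
    ENNReal.ofReal (r / 2 * ‖(tsqrt A)⁻¹ * H * (tsqrt A)⁻¹‖) ≤ RHat r A H := by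
  unfold RHat RTilde
  split_ifs
  · exact le_rfl
  · exact le_top

theorem RHat_zero (A : Tensor) : RHat r A 0 = 0 := by
  simp [RHat, RTilde]

theorem dissip_self (A : SLsymPos) : dissip r A A = 0 := by
  refine le_antisymm ?_ zero_le
  refine (iInf₂_le (fun _ => A.1) ⟨contDiffOn_const, fun _ _ => A.2, rfl, rfl⟩).trans ?_
  have h : derivWithin (fun _ : ℝ => A.1) (Icc 0 1) = fun _ => 0 := derivWithin_fun_const _ _
  rw [h]
  simp only [RHat_zero, lintegral_zero, le_refl]

theorem dissip_le {A B : SLsymPos} {γ : ℝ → Tensor} (hγ : IsAdmissibleCurve A B γ) :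
    dissip r A B ≤ ∫⁻ s in Icc (0 : ℝ) 1, RHat r (γ s) (derivWithin γ (Icc 0 1) s) :=
  iInf₂_le γ hγ

/-! #### Triangle inequality -/

theorem IsAdmissibleCurve.hasDerivWithinAt_comp {A B : SLsymPos} {γ : ℝ → Tensor}
    (hγ : IsAdmissibleCurve A B γ) {f : ℝ → ℝ} {f' s : ℝ} {S : Set ℝ} (hf : HasDerivAt f f' s)
    (hmem : ∀ s, f s ∈ Icc (0 : ℝ) 1) :
    HasDerivWithinAt (fun s => γ (f s)) (f' • derivWithin γ (Icc 0 1) (f s)) S s := by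
  have h1 : HasDerivWithinAt γ (derivWithin γ (Icc 0 1) (f s)) (Icc 0 1) (f s) :=
    (hγ.contDiffOn.differentiableOn (by norm_num) _ (hmem s)).hasDerivWithinAt
  exact h1.scomp s hf.hasDerivWithinAt fun x _ => hmem x

/-- Invariance of length under monotone reparametrization, from positive homogeneity and the change
of variables. Only an inequality, since `f` maps `S` onto possibly part of `[0, 1]`. -/
theorem IsAdmissibleCurve.lintegral_comp_le {A B : SLsymPos} {γ Γ : ℝ → Tensor}
    (hγ : IsAdmissibleCurve A B γ) {f : ℝ → ℝ} (hf : ContDiff ℝ 1 f) (hmono : Monotone f)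
    (hmem : ∀ s, f s ∈ Icc (0 : ℝ) 1) {S : Set ℝ} (hS : MeasurableSet S) (hS1 : S ⊆ Icc 0 1)
    (hΓ : ∀ s ∈ S, Γ =ᶠ[𝓝[Icc 0 1] s] fun s => γ (f s)) :
    ∫⁻ s in S, RHat r (Γ s) (derivWithin Γ (Icc 0 1) s) ≤
      ∫⁻ s in Icc (0 : ℝ) 1, RHat r (γ s) (derivWithin γ (Icc 0 1) s) := by
  have hd : ∀ s, HasDerivAt f (deriv f s) s := fun s =>
    (hf.differentiable (by norm_num) s).hasDerivAt
  calc ∫⁻ s in S, RHat r (Γ s) (derivWithin Γ (Icc 0 1) s)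
      = ∫⁻ s in S, ENNReal.ofReal (deriv f s) *
          RHat r (γ (f s)) (derivWithin γ (Icc 0 1) (f s)) := by
        refine setLIntegral_congr_fun hS fun s hs => ?_
        have h0 : Γ s = γ (f s) := (hΓ s hs).self_of_nhdsWithin (hS1 hs)
        have h1 : derivWithin Γ (Icc 0 1) s = deriv f s • derivWithin γ (Icc 0 1) (f s) :=
          ((hγ.hasDerivWithinAt_comp (hd s) hmem).congr_of_eventuallyEq (hΓ s hs) h0).derivWithin
            (uniqueDiffOn_Icc zero_lt_one s (hS1 hs))
        rw [h1, h0, RHat_smul hmono.deriv_nonneg]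
    _ = ∫⁻ u in f '' S, RHat r (γ u) (derivWithin γ (Icc 0 1) u) :=
        (lintegral_image_eq_lintegral_deriv_mul_of_monotoneOn hS
          (fun s _ => (hd s).hasDerivWithinAt) (hmono.monotoneOn S)
          (fun u => RHat r (γ u) (derivWithin γ (Icc 0 1) u))).symm
    _ ≤ _ := lintegral_mono_set (by rintro _ ⟨s, -, rfl⟩; exact hmem s)

theorem dissip_triangle (A B C : SLsymPos) :
    dissip r A C ≤ dissip r A B + dissip r B C := by
  unfold dissip
  refine ENNReal.le_iInf₂_add_iInf₂ fun γ₁ h₁ γ₂ h₂ => ?_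
  -- The first curve is finished at `1/3` and the second starts at `2/3`. Both branches rest at `B`
  -- in between, so the concatenation at `1/2` is again `C¹`.
  let f₁ : ℝ → ℝ := fun s => Real.smoothTransition (3 * s)
  let f₂ : ℝ → ℝ := fun s => Real.smoothTransition (3 * s - 2)
  have hst : ContDiff ℝ 1 Real.smoothTransition := Real.smoothTransition.contDiff (n := 1)
  have hf₁ : ContDiff ℝ 1 f₁ := hst.comp (contDiff_const.mul contDiff_id)
  have hf₂ : ContDiff ℝ 1 f₂ := hst.comp ((contDiff_const.mul contDiff_id).sub contDiff_const)
  have hm₁ : Monotone f₁ := fun x y h => Real.smoothTransition.monotone (by linarith)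
  have hm₂ : Monotone f₂ := fun x y h => Real.smoothTransition.monotone (by linarith)
  have hmem₁ : ∀ s, f₁ s ∈ Icc (0 : ℝ) 1 := fun s =>
    ⟨Real.smoothTransition.nonneg _, Real.smoothTransition.le_one _⟩
  have hmem₂ : ∀ s, f₂ s ∈ Icc (0 : ℝ) 1 := fun s =>
    ⟨Real.smoothTransition.nonneg _, Real.smoothTransition.le_one _⟩
  let Γ : ℝ → Tensor := fun s => if s ≤ 1 / 2 then γ₁ (f₁ s) else γ₂ (f₂ s)
  have hmid : ∀ s : ℝ, 1 / 3 ≤ s → s ≤ 2 / 3 → γ₁ (f₁ s) = γ₂ (f₂ s) := fun s h h' => by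
    have e1 : f₁ s = 1 := Real.smoothTransition.one_of_one_le (by linarith)
    have e2 : f₂ s = 0 := Real.smoothTransition.zero_of_nonpos (by linarith)
    rw [e1, e2, h₁.finish, h₂.start]
  have hΓ₁ : ∀ s : ℝ, s < 2 / 3 → Γ =ᶠ[𝓝[Icc 0 1] s] fun s => γ₁ (f₁ s) := fun s hs => by
    filter_upwards [mem_nhdsWithin_of_mem_nhds (Iio_mem_nhds hs)] with x hx
    by_cases h : x ≤ 1 / 2
    · exact if_pos h
    · exact (if_neg h).trans (hmid x (by linarith) (le_of_lt hx)).symm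
  have hΓ₂ : ∀ s : ℝ, 1 / 3 < s → Γ =ᶠ[𝓝[Icc 0 1] s] fun s => γ₂ (f₂ s) := fun s hs => by
    filter_upwards [mem_nhdsWithin_of_mem_nhds (Ioi_mem_nhds hs)] with x hx
    by_cases h : x ≤ 1 / 2
    · exact (if_pos h).trans (hmid x (le_of_lt hx) (by linarith))
    · exact if_neg h
  have hadm : IsAdmissibleCurve A C Γ := by
    refine ⟨fun s hs => ?_, fun s _ => ?_, ?_, ?_⟩
    · rcases lt_or_ge s (2 / 3) with h | h
      · refine ContDiffWithinAt.congr_of_eventuallyEq ?_ (hΓ₁ s h)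
          ((hΓ₁ s h).self_of_nhdsWithin hs)
        exact (h₁.contDiffOn (f₁ s) (hmem₁ s)).comp s hf₁.contDiffAt.contDiffWithinAt
          fun x _ => hmem₁ x
      · have h' : 1 / 3 < s := by linarith
        refine ContDiffWithinAt.congr_of_eventuallyEq ?_ (hΓ₂ s h')
          ((hΓ₂ s h').self_of_nhdsWithin hs)
        exact (h₂.contDiffOn (f₂ s) (hmem₂ s)).comp s hf₂.contDiffAt.contDiffWithinAt
          fun x _ => hmem₂ x
    · simp only [Γ]
      split_ifs
      · exact h₁.mem _ (hmem₁ s)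
      · exact h₂.mem _ (hmem₂ s)
    · have : f₁ 0 = 0 := Real.smoothTransition.zero_of_nonpos (by norm_num)
      simp only [Γ]
      rw [if_pos (by norm_num), this, h₁.start]
    · have : f₂ 1 = 1 := Real.smoothTransition.one_of_one_le (by norm_num)
      simp only [Γ]
      rw [if_neg (by norm_num), this, h₂.finish]
  refine (iInf₂_le Γ hadm).trans ?_
  rw [← Icc_union_Icc_eq_Icc (a := (0 : ℝ)) (b := 1 / 2) (c := 1) (by norm_num) (by norm_num)]
  refine (lintegral_union_le _ _ _).trans ?_
  rw [Icc_union_Icc_eq_Icc (a := (0 : ℝ)) (b := 1 / 2) (c := 1) (by norm_num) (by norm_num)]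
  refine add_le_add ?_ ?_
  · exact h₁.lintegral_comp_le hf₁ hm₁ hmem₁ measurableSet_Icc
      (Icc_subset_Icc_right (by norm_num)) fun s hs => hΓ₁ s (by linarith [hs.2])
  · exact h₂.lintegral_comp_le hf₂ hm₂ hmem₂ measurableSet_Icc
      (Icc_subset_Icc_left (by norm_num)) fun s hs => hΓ₂ s (by linarith [hs.1])

/-! #### Definiteness -/

theorem trace_sandwich (V M : Tensor) (hV : V.transpose = V) :
    (M.transpose * (V * V) * M).trace = ‖V * M‖ ^ 2 := by
  rw [tensor_norm_sq, Matrix.transpose_mul, hV]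
  simp only [Matrix.mul_assoc]

theorem trace_sandwich_pos {A M : Tensor} (hA : A.PosDef) (hM : M ≠ 0) :
    0 < (M.transpose * A * M).trace :=
  (trace_conj_nonneg hA.posSemidef M).lt_of_ne fun h => hM (eq_zero_of_trace_conj hA h.symm)

/-- With `N = A^{1/2} M` the left side is the pairing of `N` with `(A^{-1/2} H A^{-1/2}) N`, and the
last factor on the right is `|N|²`. -/
theorem abs_trace_sandwich_le {A : Tensor} (hA : A.PosDef) (M H : Tensor) :
    |(M.transpose * H * M).trace| ≤
      ‖(tsqrt A)⁻¹ * H * (tsqrt A)⁻¹‖ * (M.transpose * A * M).trace := by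
  set V := tsqrt A with hV
  have h1 : V * V⁻¹ = 1 := tsqrt_mul_inv hA
  have h2 : V⁻¹ * V = 1 := tsqrt_inv_mul hA
  have h3 : M.transpose * H * M = (V * M).transpose * ((V⁻¹ * H * V⁻¹) * (V * M)) := by
    rw [Matrix.transpose_mul, hV, tsqrt_transpose, ← hV]
    calc M.transpose * H * M = M.transpose * (V * V⁻¹) * H * (V⁻¹ * V) * M := by
          rw [h1, h2]; simp only [Matrix.mul_one]
      _ = _ := by simp only [Matrix.mul_assoc]
  have h4 : (M.transpose * A * M).trace = ‖V * M‖ ^ 2 := by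
    rw [← trace_sandwich V M (tsqrt_transpose A), hV, tsqrt_mul_self hA.posSemidef]
  rw [h3, h4]
  refine (abs_trace_transpose_mul_le _ _).trans ?_
  have := Matrix.frobenius_norm_mul (V⁻¹ * H * V⁻¹) (V * M)
  nlinarith [norm_nonneg (V * M)]

/-- Along any curve the logarithmic derivative of `tr (Mᵀ γ M)` is at most `|γ^{-1/2} γ̇ γ^{-1/2}|`;
integrate. Since `M` is arbitrary, a vanishing distance forces `A` and `B` to define the same
quadratic form. -/
theorem ofReal_abs_log_le_dissip (hr : 0 ≤ r) (A B : SLsymPos) {M : Tensor} (hM : M ≠ 0) :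
    ENNReal.ofReal (r / 2 * |Real.log (M.transpose * B.1 * M).trace -
      Real.log (M.transpose * A.1 * M).trace|) ≤ dissip r A B := by
  refine le_iInf₂ fun γ hγ => ?_
  let ℓ : Tensor →L[ℝ] ℝ := LinearMap.toContinuousLinearMap
    ((Matrix.traceLinearMap (Fin 3) ℝ ℝ) ∘ₗ (LinearMap.mulRight ℝ M) ∘ₗ
      (LinearMap.mulLeft ℝ M.transpose) : Tensor →ₗ[ℝ] ℝ)
  have hℓ : ∀ X, ℓ X = (M.transpose * X * M).trace := fun X => rfl
  have hpos : ∀ s ∈ Icc (0 : ℝ) 1, 0 < ℓ (γ s) := fun s hs => by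
    rw [hℓ]; exact trace_sandwich_pos (hγ.mem s hs).1 hM
  have hcd : ContDiffOn ℝ 1 (fun s => r / 2 * Real.log (ℓ (γ s))) (Icc 0 1) :=
    contDiffOn_const.mul
      ((ℓ.contDiff.comp_contDiffOn hγ.contDiffOn).log fun s hs => (hpos s hs).ne')
  have h1 := enorm_sub_le_lintegral_derivWithin_Icc_of_contDiffOn_Icc hcd zero_le_one
  have h2 : ENNReal.ofReal (r / 2 * |Real.log (M.transpose * B.1 * M).trace -
      Real.log (M.transpose * A.1 * M).trace|) =
      ‖r / 2 * Real.log (ℓ (γ 1)) - r / 2 * Real.log (ℓ (γ 0))‖ₑ := by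
    rw [hγ.start, hγ.finish, hℓ, hℓ, ← mul_sub, ← ofReal_norm, Real.norm_eq_abs, abs_mul,
      abs_of_nonneg (by positivity : 0 ≤ r / 2)]
  rw [h2]
  refine h1.trans (setLIntegral_mono' measurableSet_Icc fun s hs => ?_)
  refine le_trans ?_ (ofReal_norm_le_RHat _ _)
  have hd : HasDerivWithinAt (fun s => r / 2 * Real.log (ℓ (γ s)))
      (r / 2 * (ℓ (derivWithin γ (Icc 0 1) s) / ℓ (γ s))) (Icc 0 1) s := by
    have h3 : HasDerivWithinAt γ (derivWithin γ (Icc 0 1) s) (Icc 0 1) s :=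
      (hγ.contDiffOn.differentiableOn (by norm_num) s hs).hasDerivWithinAt
    exact ((ℓ.hasFDerivAt.comp_hasDerivWithinAt s h3).log (hpos s hs).ne').const_mul _
  rw [hd.derivWithin (uniqueDiffOn_Icc zero_lt_one s hs), ← ofReal_norm]
  refine ENNReal.ofReal_le_ofReal ?_
  rw [Real.norm_eq_abs, abs_mul, abs_of_nonneg (by positivity : 0 ≤ r / 2), abs_div,
    abs_of_pos (hpos s hs)]
  refine mul_le_mul_of_nonneg_left ?_ (by positivity)
  rw [div_le_iff₀ (hpos s hs), hℓ, hℓ]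
  exact abs_trace_sandwich_le (hγ.mem s hs).1 _ _

theorem eq_zero_of_trace_sandwich {X : Tensor} (hX : X.transpose = X)
    (h : ∀ M : Tensor, (M.transpose * X * M).trace = 0) : X = 0 := by
  -- Polarization: the difference of the forms at `1 + X` and `1 - X` is `4 tr (X²) = 4 |X|²`.
  have h1 := h (1 + X)
  have h2 := h (1 - X)
  rw [Matrix.transpose_add, hX, Matrix.transpose_one] at h1
  rw [Matrix.transpose_sub, hX, Matrix.transpose_one] at h2
  have h3 : (1 + X) * X * (1 + X) - (1 - X) * X * (1 - X) = (4 : ℝ) • (X * X) := by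
    have : (4 : ℝ) • (X * X) = 4 * (X * X) := by
      rw [show (4 : ℝ) = ((4 : ℕ) : ℝ) by norm_num, Nat.cast_smul_eq_nsmul, nsmul_eq_mul]; norm_num
    rw [this]; noncomm_ring
  have h4 : ‖X‖ ^ 2 = 0 := by
    have := congrArg Matrix.trace h3
    rw [Matrix.trace_sub, h1, h2, Matrix.trace_smul, smul_eq_mul] at this
    rw [tensor_norm_sq, hX]; linarith
  simpa using h4

theorem eq_of_dissip_eq_zero (hr : 0 < r) {A B : SLsymPos} (h : dissip r A B = 0) : A = B := by
  have hAB : A.1 - B.1 = 0 := by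
    refine eq_zero_of_trace_sandwich ?_ fun M => ?_
    · rw [Matrix.transpose_sub, A.2.1.transpose_eq, B.2.1.transpose_eq]
    · by_cases hM : M = 0
      · simp [hM]
      have h1 := ofReal_abs_log_le_dissip hr.le A B hM
      rw [h, nonpos_iff_eq_zero, ENNReal.ofReal_eq_zero] at h1
      have h2 : |Real.log (M.transpose * B.1 * M).trace -
          Real.log (M.transpose * A.1 * M).trace| = 0 :=
        le_antisymm (nonpos_of_mul_nonpos_right h1 (by positivity)) (abs_nonneg _)
      have h3 := Real.log_injOn_pos (trace_sandwich_pos B.2.1 hM) (trace_sandwich_pos A.2.1 hM)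
        (sub_eq_zero.1 (abs_eq_zero.1 h2))
      rw [Matrix.mul_sub, Matrix.sub_mul, Matrix.trace_sub, h3, sub_self]
  exact Subtype.ext (sub_eq_zero.1 hAB)

end Dissipation

/-! #### Continuity of the dissipation metric -/

section DissipationUpper

variable {r : ℝ}

/-- Diagonalize `A^{-1/2} B A^{-1/2} = U diag Uᵀ` and take `P = Uᵀ A^{1/2}`. The eigenvalues are
written as exponentials so that scaling `μ` by `s` interpolates between `A` and `B`. -/
theorem exists_simultaneous_diagonalization {A B : Tensor} (hA : A.PosDef) (hB : B.PosDef) :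
    ∃ (P : Tensor) (μ : Fin 3 → ℝ), P.det ≠ 0 ∧ A = P.transpose * P ∧
      B = P.transpose * Matrix.diagonal (fun i => Real.exp (μ i)) * P := by
  set S := tsqrt A with hS
  have hSdet : S.det ≠ 0 := (det_tsqrt_pos hA).ne'
  have hinv : IsUnit (S⁻¹) := (Matrix.isUnit_iff_isUnit_det _).2 (det_tsqrt_inv_pos hA).ne'.isUnit
  have hST : S⁻¹.transpose = S⁻¹ := by rw [Matrix.transpose_nonsing_inv, hS, tsqrt_transpose]
  have hX : (S⁻¹ * B * S⁻¹).PosDef := by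
    have h := hB.conjTranspose_mul_mul_same (B := S⁻¹) (Matrix.mulVec_injective_iff_isUnit.2 hinv)
    rwa [Matrix.conjTranspose_eq_transpose_of_trivial, hST] at h
  obtain ⟨U, ev, hU, hev, hspec⟩ : ∃ (U : Tensor) (ev : Fin 3 → ℝ), U * U.transpose = 1 ∧
      (∀ i, 0 < ev i) ∧ S⁻¹ * B * S⁻¹ = U * Matrix.diagonal ev * U.transpose := by
    refine ⟨hX.1.eigenvectorUnitary, hX.1.eigenvalues, ?_, hX.eigenvalues_pos, ?_⟩
    · have := Unitary.mul_star_self_of_mem hX.1.eigenvectorUnitary.2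
      rwa [Matrix.star_eq_conjTranspose, Matrix.conjTranspose_eq_transpose_of_trivial] at this
    · have := hX.1.spectral_theorem
      rw [Unitary.conjStarAlgAut_apply, Matrix.star_eq_conjTranspose,
        Matrix.conjTranspose_eq_transpose_of_trivial] at this
      exact this
  refine ⟨U.transpose * S, fun i => Real.log (ev i), ?_, ?_, ?_⟩
  · have := congrArg Matrix.det hU
    rw [Matrix.det_mul, Matrix.det_one, Matrix.det_transpose] at this
    rw [Matrix.det_mul, Matrix.det_transpose]
    exact mul_ne_zero (left_ne_zero_of_mul_eq_one this) hSdet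
  · rw [Matrix.transpose_mul, Matrix.transpose_transpose, hS, tsqrt_transpose, Matrix.mul_assoc,
      ← Matrix.mul_assoc U, hU, Matrix.one_mul, tsqrt_mul_self hA.posSemidef]
  · simp only [Real.exp_log (hev _)]
    rw [Matrix.transpose_mul, Matrix.transpose_transpose, hS, tsqrt_transpose, ← hS]
    calc B = (S * S⁻¹) * B * (S⁻¹ * S) := by
          rw [hS, tsqrt_mul_inv hA, tsqrt_inv_mul hA, Matrix.one_mul, Matrix.mul_one]
      _ = S * (S⁻¹ * B * S⁻¹) * S := by simp only [Matrix.mul_assoc]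
      _ = _ := by rw [hspec]; simp only [Matrix.mul_assoc]

/-- The symmetric tensor `A^{-1/2} H A^{-1/2}` is similar to `Z = A⁻¹ H`, so its trace and its norm
can be read off from `Z` without any square root of `A`. -/
theorem RHat_eq_of_mul_eq {A H Z : Tensor} (hA : A.PosDef) (hH : H.transpose = H)
    (hZ : A * Z = H) (htr : Z.trace = 0) :
    RHat r A H = ENNReal.ofReal (r / 2 * √(Z * Z).trace) := by
  set V := tsqrt A with hV
  have h1 : V * V⁻¹ = 1 := tsqrt_mul_inv hA
  have h2 : V⁻¹ * V = 1 := tsqrt_inv_mul hA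
  have hVV : V * V = A := tsqrt_mul_self hA.posSemidef
  have hVT : V⁻¹.transpose = V⁻¹ := by rw [Matrix.transpose_nonsing_inv, hV, tsqrt_transpose]
  have hY : V⁻¹ * H * V⁻¹ = V * Z * V⁻¹ := by
    rw [← hZ, ← hVV]
    calc V⁻¹ * (V * V * Z) * V⁻¹ = (V⁻¹ * V) * (V * Z * V⁻¹) := by simp only [Matrix.mul_assoc]
      _ = _ := by rw [h2, Matrix.one_mul]
  have hYT : (V⁻¹ * H * V⁻¹).transpose = V⁻¹ * H * V⁻¹ := by
    simp only [Matrix.transpose_mul, hVT, hH, Matrix.mul_assoc]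
  have htr' : (V⁻¹ * H * V⁻¹).trace = 0 := by
    rw [hY, Matrix.trace_mul_comm, ← Matrix.mul_assoc, h2, Matrix.one_mul, htr]
  have hn : ‖V⁻¹ * H * V⁻¹‖ ^ 2 = (Z * Z).trace := by
    rw [tensor_norm_sq, hYT, hY, show V * Z * V⁻¹ * (V * Z * V⁻¹) = V * (Z * (V⁻¹ * V) * Z * V⁻¹) by
      simp only [Matrix.mul_assoc], Matrix.trace_mul_comm, h2, Matrix.mul_one,
      Matrix.mul_assoc (Z * Z), h2, Matrix.mul_one]
  rw [RHat, RTilde, ← hV, if_pos htr', ← hn, Real.sqrt_sq (norm_nonneg _)]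

/-- The right side is `4 sinh² (x/2)`, and `|y| ≤ |sinh y|`. -/
theorem sq_le_exp_add_exp_neg (x : ℝ) : x ^ 2 ≤ Real.exp x + Real.exp (-x) - 2 := by
  have h1 : |x / 2| ≤ |Real.sinh (x / 2)| := by
    rw [Real.abs_sinh]
    exact Real.self_le_sinh_iff.2 (abs_nonneg _)
  have h2 := sq_le_sq.2 h1
  have h3 : Real.exp (x / 2) * Real.exp (x / 2) = Real.exp x := by
    rw [← Real.exp_add]; congr 1; ring
  have h4 : Real.exp (-(x / 2)) * Real.exp (-(x / 2)) = Real.exp (-x) := by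
    rw [← Real.exp_add]; congr 1; ring
  have h5 : Real.exp (x / 2) * Real.exp (-(x / 2)) = 1 := by
    rw [← Real.exp_add, add_neg_cancel, Real.exp_zero]
  rw [Real.sinh_eq] at h2
  nlinarith

/-- The curve `Pᵀ diag (exp (s μ)) P` has constant speed `(r/2) |μ|`, and `det = 1` at both ends
means `∑ μ = 0`, which keeps it in the state space. Bounding `μ²` by exponentials expresses the
length through traces, which are visibly continuous in `(A, B)` and vanish on the diagonal;
continuity of eigenvalues is not needed. -/
theorem dissip_le_sqrt_trace (hr : 0 ≤ r) (A B : SLsymPos) :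
    dissip r A B ≤
      ENNReal.ofReal (r / 2 * √((A.1⁻¹ * B.1).trace + (B.1⁻¹ * A.1).trace - 6)) := by
  obtain ⟨P, μ, hP, hAP, hBP⟩ := exists_simultaneous_diagonalization A.2.1 B.2.1
  have h1 : P * P⁻¹ = 1 := Matrix.mul_nonsing_inv _ hP.isUnit
  have h2 : P⁻¹ * P = 1 := Matrix.nonsing_inv_mul _ hP.isUnit
  have hdetP : P.det * P.det = 1 := by
    have := A.2.2; rwa [hAP, Matrix.det_mul, Matrix.det_transpose] at this
  have hμ : ∑ i, μ i = 0 := by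
    have := B.2.2
    rw [hBP, Matrix.det_mul, Matrix.det_mul, Matrix.det_transpose, Matrix.det_diagonal,
      ← Real.exp_sum, mul_right_comm, hdetP, one_mul] at this
    exact Real.exp_eq_one_iff _ |>.1 this
  let E : ℝ → Tensor := fun s => Matrix.diagonal fun i => Real.exp (s * μ i)
  have hE : ∀ s, E s = Matrix.diagonal fun i => Real.exp (s * μ i) := fun _ => rfl
  let γ : ℝ → Tensor := fun s => P.transpose * E s * P
  have hγpos : ∀ s, (γ s).PosDef := fun s => by
    have hd : (E s).PosDef := Matrix.PosDef.diagonal fun i => Real.exp_pos _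
    have h := hd.conjTranspose_mul_mul_same (B := P)
      (Matrix.mulVec_injective_iff_isUnit.2 ((Matrix.isUnit_iff_isUnit_det P).2 hP.isUnit))
    rwa [Matrix.conjTranspose_eq_transpose_of_trivial] at h
  have hγdet : ∀ s, (γ s).det = 1 := fun s => by
    simp only [γ, hE]
    rw [Matrix.det_mul, Matrix.det_mul, Matrix.det_transpose, Matrix.det_diagonal, mul_right_comm,
      hdetP, ← Real.exp_sum, ← Finset.mul_sum, hμ, mul_zero, Real.exp_zero, one_mul]
  have hEd : ContDiff ℝ 1 E := by
    have hc : ContDiff ℝ 1 fun s : ℝ => fun i : Fin 3 => Real.exp (s * μ i) :=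
      contDiff_pi.2 fun i => (contDiff_id.mul contDiff_const).exp
    exact (LinearMap.toContinuousLinearMap (Matrix.diagonalLinearMap (Fin 3) ℝ ℝ)).contDiff.comp hc
  have hE' : ∀ s, HasDerivAt E (Matrix.diagonal fun i => μ i * Real.exp (s * μ i)) s := fun s => by
    have hc : HasDerivAt (fun s : ℝ => fun i : Fin 3 => Real.exp (s * μ i))
        (fun i => μ i * Real.exp (s * μ i)) s := hasDerivAt_pi.2 fun i => by
      have := ((hasDerivAt_id s).mul_const (μ i)).exp
      simpa [mul_comm] using this
    exact (LinearMap.toContinuousLinearMap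
      (Matrix.diagonalLinearMap (Fin 3) ℝ ℝ)).hasFDerivAt.comp_hasDerivAt s hc
  have hadm : IsAdmissibleCurve A B γ := by
    refine ⟨((contDiff_const.mul hEd).mul contDiff_const).contDiffOn,
      fun s _ => ⟨hγpos s, hγdet s⟩, ?_, ?_⟩
    · simp only [γ, hE, zero_mul, Real.exp_zero, Matrix.diagonal_one, Matrix.mul_one]
      exact hAP.symm
    · simp only [γ, hE, one_mul]
      exact hBP.symm
  let Z : Tensor := P⁻¹ * Matrix.diagonal μ * P
  have hZ : Z.trace = 0 := by
    simp only [Z]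
    rw [Matrix.trace_mul_comm, ← Matrix.mul_assoc, h1, Matrix.one_mul, Matrix.trace_diagonal, hμ]
  have hZZ : (Z * Z).trace = ∑ i, μ i ^ 2 := by
    simp only [Z]
    rw [show P⁻¹ * Matrix.diagonal μ * P * (P⁻¹ * Matrix.diagonal μ * P) =
      P⁻¹ * (Matrix.diagonal μ * (P * P⁻¹) * Matrix.diagonal μ * P) by
        simp only [Matrix.mul_assoc], Matrix.trace_mul_comm, h1, Matrix.mul_one, Matrix.mul_assoc,
      h1, Matrix.mul_one, Matrix.diagonal_mul_diagonal, Matrix.trace_diagonal]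
    simp only [sq]
  have hR : ∀ s ∈ Icc (0 : ℝ) 1, RHat r (γ s) (derivWithin γ (Icc 0 1) s) =
      ENNReal.ofReal (r / 2 * √(∑ i, μ i ^ 2)) := fun s hs => by
    have hd : HasDerivAt γ (P.transpose * (Matrix.diagonal fun i => μ i * Real.exp (s * μ i)) * P)
      s := ((hE' s).const_mul _).mul_const _
    have hd' : derivWithin γ (Icc 0 1) s = _ :=
      hd.hasDerivWithinAt.derivWithin (uniqueDiffOn_Icc zero_lt_one s hs)
    rw [hd', ← hZZ]
    refine RHat_eq_of_mul_eq (hγpos s) ?_ ?_ hZ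
    · simp only [Matrix.transpose_mul, Matrix.transpose_transpose, Matrix.diagonal_transpose,
        Matrix.mul_assoc]
    · simp only [γ, Z, hE]
      rw [show P.transpose * (Matrix.diagonal fun i => Real.exp (s * μ i)) * P *
          (P⁻¹ * Matrix.diagonal μ * P) =
          P.transpose * (Matrix.diagonal fun i => Real.exp (s * μ i)) * (P * P⁻¹) *
          Matrix.diagonal μ * P by simp only [Matrix.mul_assoc], h1, Matrix.mul_one,
        Matrix.mul_assoc P.transpose, Matrix.diagonal_mul_diagonal]
      simp only [mul_comm]
  refine (dissip_le hadm).trans ?_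
  rw [setLIntegral_congr_fun measurableSet_Icc hR, setLIntegral_const, Real.volume_Icc, sub_zero,
    ENNReal.ofReal_one, mul_one]
  refine ENNReal.ofReal_le_ofReal (mul_le_mul_of_nonneg_left (Real.sqrt_le_sqrt ?_) (by positivity))
  have hAB : (A.1⁻¹ * B.1).trace = ∑ i, Real.exp (μ i) := by
    rw [hAP, hBP, Matrix.mul_inv_rev, show P⁻¹ * P.transpose⁻¹ *
      (P.transpose * (Matrix.diagonal fun i => Real.exp (μ i)) * P) = P⁻¹ * ((P.transpose⁻¹ *
      P.transpose) * (Matrix.diagonal fun i => Real.exp (μ i)) * P) by simp only [Matrix.mul_assoc],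
      Matrix.nonsing_inv_mul _ (by rw [Matrix.det_transpose]; exact hP.isUnit), Matrix.trace_mul_comm,
      Matrix.one_mul, Matrix.mul_assoc, h1, Matrix.mul_one, Matrix.trace_diagonal]
  have hBA : (B.1⁻¹ * A.1).trace = ∑ i, Real.exp (-μ i) := by
    have hBinv : B.1⁻¹ = P⁻¹ * (Matrix.diagonal fun i => Real.exp (-μ i)) * P⁻¹.transpose := by
      refine Matrix.inv_eq_right_inv ?_
      rw [hBP, show P.transpose * (Matrix.diagonal fun i => Real.exp (μ i)) * P *
        (P⁻¹ * (Matrix.diagonal fun i => Real.exp (-μ i)) * P⁻¹.transpose) = P.transpose *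
        ((Matrix.diagonal fun i => Real.exp (μ i)) * (P * P⁻¹) *
        (Matrix.diagonal fun i => Real.exp (-μ i))) * P⁻¹.transpose by simp only [Matrix.mul_assoc],
        h1, Matrix.mul_one, Matrix.diagonal_mul_diagonal]
      simp only [← Real.exp_add, add_neg_cancel, Real.exp_zero, Matrix.diagonal_one, Matrix.mul_one]
      rw [← Matrix.transpose_mul, h2, Matrix.transpose_one]
    rw [hBinv, hAP, show P⁻¹ * (Matrix.diagonal fun i => Real.exp (-μ i)) * P⁻¹.transpose *
      (P.transpose * P) = P⁻¹ * ((Matrix.diagonal fun i => Real.exp (-μ i)) *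
      (P⁻¹.transpose * P.transpose) * P) by simp only [Matrix.mul_assoc], ← Matrix.transpose_mul, h1,
      Matrix.transpose_one, Matrix.mul_one, Matrix.trace_mul_comm, Matrix.mul_assoc, h1,
      Matrix.mul_one, Matrix.trace_diagonal]
  rw [hAB, hBA, ← Finset.sum_add_distrib]
  have h6 : (6 : ℝ) = ∑ _i : Fin 3, 2 := by simp; norm_num
  rw [h6, ← Finset.sum_sub_distrib]
  exact Finset.sum_le_sum fun i _ => sq_le_exp_add_exp_neg (μ i)

theorem dissip_ne_top (hr : 0 ≤ r) (A B : SLsymPos) : dissip r A B ≠ ⊤ :=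
  ((dissip_le_sqrt_trace hr A B).trans_lt ENNReal.ofReal_lt_top).ne

/-- A finite premetric satisfying the triangle inequality is continuous as soon as it is dominated
by a continuous function vanishing on the diagonal. -/
theorem continuous_of_le_of_triangle {Q : Type*} [TopologicalSpace Q] {D b : Q → Q → ℝ≥0∞}
    (hD : ∀ x y, D x y ≠ ⊤) (htri : ∀ x y z, D x z ≤ D x y + D y z)
    (hb : Continuous (Function.uncurry b)) (hb0 : ∀ x, b x x = 0) (hle : ∀ x y, D x y ≤ b x y) :
    Continuous (Function.uncurry D) := by
  refine continuous_iff_continuousAt.2 fun ⟨x, y⟩ => ?_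
  have h1 : Tendsto (fun z : Q × Q => b z.1 x + D x y + b y z.2) (𝓝 (x, y)) (𝓝 (D x y)) := by
    have : Continuous fun z : Q × Q => b z.1 x + D x y + b y z.2 :=
      ((hb.comp (continuous_fst.prodMk continuous_const)).add continuous_const).add
        (hb.comp (continuous_const.prodMk continuous_snd))
    have h := this.tendsto (x, y)
    simpa only [hb0, zero_add, add_zero] using h
  have h2 : Tendsto (fun z : Q × Q => D x y - (b x z.1 + b z.2 y)) (𝓝 (x, y)) (𝓝 (D x y)) := by
    have hc : Continuous fun z : Q × Q => b x z.1 + b z.2 y :=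
      (hb.comp (continuous_const.prodMk continuous_fst)).add
        (hb.comp (continuous_snd.prodMk continuous_const))
    have h := ENNReal.Tendsto.sub (tendsto_const_nhds (x := D x y)) (hc.tendsto (x, y))
      (Or.inl (hD x y))
    simpa only [hb0, zero_add, tsub_zero] using h
  refine tendsto_of_tendsto_of_tendsto_of_le_of_le h2 h1 (fun z => ?_) fun z => ?_
  · rw [tsub_le_iff_right]
    calc D x y ≤ D x z.1 + (D z.1 z.2 + D z.2 y) := (htri _ z.1 _).trans
          (add_le_add le_rfl (htri _ _ _))
      _ ≤ b x z.1 + (D z.1 z.2 + b z.2 y) := by gcongr <;> exact hle _ _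
      _ = D z.1 z.2 + (b x z.1 + b z.2 y) := by ring
  · calc D z.1 z.2 ≤ D z.1 x + D x y + D y z.2 := (htri _ y _).trans
          (add_le_add (htri _ _ _) le_rfl)
      _ ≤ _ := by gcongr <;> exact hle _ _

theorem continuous_dissip (hr : 0 ≤ r) : Continuous (Function.uncurry (dissip r)) := by
  refine continuous_of_le_of_triangle (dissip_ne_top hr) dissip_triangle
    (b := fun A B => ENNReal.ofReal (r / 2 * √((A.1⁻¹ * B.1).trace + (B.1⁻¹ * A.1).trace - 6)))
    ?_ (fun A => ?_) (dissip_le_sqrt_trace hr)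
  · have hinv : Continuous fun A : SLsymPos => (A.1)⁻¹ := continuous_iff_continuousAt.2 fun A =>
      (continuousAt_tensor_inv A.2.1.det_pos.ne').comp continuous_subtype_val.continuousAt
    have hv : Continuous fun A : SLsymPos => A.1 := continuous_subtype_val
    refine ENNReal.continuous_ofReal.comp (continuous_const.mul (Real.continuous_sqrt.comp ?_))
    exact ((((hinv.comp continuous_fst).mul (hv.comp continuous_snd)).matrix_trace).add
      (((hinv.comp continuous_snd).mul (hv.comp continuous_fst)).matrix_trace)).sub continuous_const
  · rw [Matrix.nonsing_inv_mul _ A.2.1.det_pos.ne'.isUnit]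
    norm_num

end DissipationUpper

/-! ### Helly's selection principle -/

/-- Diagonal extraction: a sequence of maps from a countable type into a compact set has a pointwise
convergent subsequence. -/
theorem exists_subseq_tendsto_pi {ι X : Type*} [Countable ι] [TopologicalSpace X]
    [FirstCountableTopology X] {K : Set X} (hK : IsCompact K) (u : ℕ → ι → X)
    (hu : ∀ k i, u k i ∈ K) :
    ∃ (φ : ℕ → ℕ) (g : ι → X), StrictMono φ ∧ (∀ i, g i ∈ K) ∧
      ∀ i, Tendsto (fun k => u (φ k) i) atTop (𝓝 (g i)) := by
  obtain ⟨g, hg, φ, hφ, hlim⟩ := (isCompact_univ_pi fun _ : ι => hK).tendsto_subseq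
    (x := u) fun k i _ => hu k i
  exact ⟨φ, g, hφ, fun i => hg i (mem_univ i), fun i => (tendsto_pi_nhds.1 hlim) i⟩

/-- Helly's selection principle for monotone functions. -/
theorem exists_subseq_tendsto_of_monotone {a b : ℝ} (f : ℕ → ℝ → ℝ) (hf : ∀ k, Monotone (f k))
    (hab : ∀ k t, f k t ∈ Icc a b) :
    ∃ (φ : ℕ → ℕ) (g : ℝ → ℝ), StrictMono φ ∧ Monotone g ∧
      ∀ t, Tendsto (fun k => f (φ k) t) atTop (𝓝 (g t)) := by
  obtain ⟨φ, h, hφ, hhab, hlim⟩ := exists_subseq_tendsto_pi isCompact_Icc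
    (fun k (q : ℚ) => f k q) fun k q => hab k q
  have hhmono : Monotone h := fun p q hpq => le_of_tendsto_of_tendsto' (hlim p) (hlim q)
    fun k => hf _ (by exact_mod_cast hpq)
  -- `H` is monotone, so it has countably many discontinuities. At its continuity points the values
  -- at nearby rationals squeeze the sequence; a second extraction treats the remaining points.
  let H : ℝ → ℝ := fun t => sSup (h '' {q : ℚ | (q : ℝ) < t})
  have hbdd : ∀ t, BddAbove (h '' {q : ℚ | (q : ℝ) < t}) := fun t =>
    ⟨b, by rintro _ ⟨q, -, rfl⟩; exact (hhab q).2⟩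
  have hne : ∀ t, (h '' {q : ℚ | (q : ℝ) < t}).Nonempty := fun t => by
    obtain ⟨q, hq⟩ := exists_rat_lt t
    exact ⟨_, q, hq, rfl⟩
  have hHmono : Monotone H := fun s t hst => csSup_le_csSup (hbdd t) (hne s)
    (image_mono fun q (hq : (q : ℝ) < s) => lt_of_lt_of_le hq hst)
  have hle : ∀ (q : ℚ) (t : ℝ), (q : ℝ) < t → h q ≤ H t := fun q t hq =>
    le_csSup (hbdd t) ⟨q, hq, rfl⟩
  have hge : ∀ (q : ℚ) (t : ℝ), t ≤ q → H t ≤ h q := fun q t hq => by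
    refine csSup_le (hne t) ?_
    rintro _ ⟨p, hp, rfl⟩
    exact hhmono (by exact_mod_cast (lt_of_lt_of_le hp hq).le)
  have hcont : ∀ t, ContinuousAt H t → Tendsto (fun k => f (φ k) t) atTop (𝓝 (H t)) := by
    intro t ht
    refine tendsto_order.2 ⟨fun x hx => ?_, fun x hx => ?_⟩
    · obtain ⟨_, ⟨q, hq, rfl⟩, hxq⟩ := exists_lt_of_lt_csSup (hne t) hx
      filter_upwards [(hlim q).eventually (lt_mem_nhds hxq)] with k hk
      exact lt_of_lt_of_le hk (hf _ (le_of_lt hq))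
    · have h1 := ht.eventually (gt_mem_nhds hx)
      obtain ⟨s, hs, hsx⟩ : ∃ s, t < s ∧ H s < x := by
        have h2 : ∀ᶠ s in 𝓝[>] t, H s < x := nhdsWithin_le_nhds h1
        obtain ⟨s, hs⟩ := (h2.and self_mem_nhdsWithin).exists
        exact ⟨s, hs.2, hs.1⟩
      obtain ⟨q, hq1, hq2⟩ := exists_rat_btwn hs
      filter_upwards [(hlim q).eventually (gt_mem_nhds ((hle q s hq2).trans_lt hsx))] with k hk
      exact lt_of_le_of_lt (hf _ hq1.le) hk
  have hctbl := hHmono.countable_not_continuousAt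
  have : Countable {t | ¬ContinuousAt H t} := hctbl.to_subtype
  obtain ⟨ψ, g, hψ, -, hg⟩ := exists_subseq_tendsto_pi isCompact_Icc
    (fun k (t : {t | ¬ContinuousAt H t}) => f (φ k) t) fun k t => hab _ t
  have hall : ∀ t, ∃ y, Tendsto (fun k => f (φ (ψ k)) t) atTop (𝓝 y) := fun t => by
    by_cases ht : ContinuousAt H t
    · exact ⟨_, (hcont t ht).comp hψ.tendsto_atTop⟩
    · exact ⟨_, hg ⟨t, ht⟩⟩
  choose G hG using hall
  exact ⟨φ ∘ ψ, G, hφ.comp hψ, fun s t hst => le_of_tendsto_of_tendsto' (hG s) (hG t)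
    fun k => hf _ hst, hG⟩

/-- In a compact set, convergence with respect to a continuous definite function `D` implies
convergence. -/
theorem tendsto_of_tendsto_zero {X α : Type*} [TopologicalSpace X] [FirstCountableTopology X]
    {l : Filter α} [l.IsCountablyGenerated] {K : Set X} (hK : IsCompact K) {D : X → X → ℝ≥0∞}
    (hD : Continuous (Function.uncurry D)) (hD0 : ∀ x y, D x y = 0 → x = y) {u : α → X} {x : X}
    (hu : ∀ᶠ k in l, u k ∈ K) (h : Tendsto (fun k => D (u k) x) l (𝓝 0)) :
    Tendsto u l (𝓝 x) := by
  refine tendsto_of_seq_tendsto fun a ha => tendsto_of_subseq_tendsto fun ns hns => ?_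
  obtain ⟨y, -, φ, hφ, hy⟩ := hK.tendsto_subseq' (x := fun n => u (a (ns n)))
    (((ha.comp hns).eventually hu).frequently)
  refine ⟨φ, ?_⟩
  have h1 : Tendsto (fun n => D (u (a (ns (φ n)))) x) atTop (𝓝 (D y x)) :=
    (hD.tendsto (y, x)).comp (hy.prodMk_nhds tendsto_const_nhds)
  have h2 : Tendsto (fun n => D (u (a (ns (φ n)))) x) atTop (𝓝 0) :=
    h.comp (ha.comp (hns.comp hφ.tendsto_atTop))
  rw [← hD0 y x (tendsto_nhds_unique h1 h2)]
  exact hy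

/-- Helly's selection principle for maps into a compact set whose variation with respect to a
continuous definite function `D` is controlled by monotone functions. -/
theorem exists_subseq_tendsto_of_variation_le {X : Type*} [TopologicalSpace X]
    [FirstCountableTopology X] {K : Set X} (hK : IsCompact K) {D : X → X → ℝ≥0∞}
    (hD : Continuous (Function.uncurry D)) (hD0 : ∀ x y, D x y = 0 → x = y) {a b : ℝ}
    (f : ℕ → ℝ → ℝ) (hf : ∀ k, Monotone (f k)) (hab : ∀ k t, f k t ∈ Icc a b) (u : ℕ → ℝ → X)
    (hu : ∀ k t, u k t ∈ K)
    (huf : ∀ k s t, s ≤ t → D (u k s) (u k t) ≤ ENNReal.ofReal (f k t - f k s)) :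
    ∃ (φ : ℕ → ℕ) (g : ℝ → ℝ) (v : ℝ → X), StrictMono φ ∧ Monotone g ∧
      (∀ t, Tendsto (fun k => f (φ k) t) atTop (𝓝 (g t))) ∧
      ∀ t, Tendsto (fun k => u (φ k) t) atTop (𝓝 (v t)) := by
  obtain ⟨φ, g, hφ, hg, hfg⟩ := exists_subseq_tendsto_of_monotone f hf hab
  have : Countable {t | ¬ContinuousAt g t} := hg.countable_not_continuousAt.to_subtype
  obtain ⟨ψ, w, hψ, hwK, hw⟩ := exists_subseq_tendsto_pi hK
    (fun k (t : {t | ¬ContinuousAt g t} ⊕ ℚ) => u (φ k) (t.elim (fun t => t.1) fun q => (q : ℝ)))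
    fun k t => hu _ _
  have hfg' : ∀ t, Tendsto (fun k => f (φ (ψ k)) t) atTop (𝓝 (g t)) := fun t =>
    (hfg t).comp hψ.tendsto_atTop
  have hall : ∀ t, ∃ y, Tendsto (fun k => u (φ (ψ k)) t) atTop (𝓝 y) := fun t => by
    by_cases ht : ContinuousAt g t
    swap
    · exact ⟨_, hw (Sum.inl ⟨t, ht⟩)⟩
    -- At a continuity point of `g`, the variation between `q n` and `t` tends to zero. Hence every
    -- cluster point `x` of the values at `t` satisfies `D z x = 0`, with `z` a cluster point of the
    -- limits at the rationals `q n`; so `x = z`.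
    have hq : ∀ n : ℕ, ∃ q : ℚ, t - 1 / ((n : ℝ) + 1) < q ∧ (q : ℝ) < t := fun n =>
      exists_rat_btwn (sub_lt_self t (by positivity))
    choose q hq1 hq2 using hq
    have hqt : Tendsto (fun n => (q n : ℝ)) atTop (𝓝 t) := by
      refine tendsto_of_tendsto_of_tendsto_of_le_of_le ?_ tendsto_const_nhds
        (fun n => (hq1 n).le) fun n => (hq2 n).le
      simpa using (tendsto_const_nhds (x := t)).sub (tendsto_one_div_add_atTop_nhds_zero_nat (𝕜 := ℝ))
    obtain ⟨z, -, θ, hθ, hz⟩ := hK.tendsto_subseq (x := fun n => w (Sum.inr (q n)))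
      fun n => hwK _
    refine ⟨z, tendsto_of_subseq_tendsto fun ns hns => ?_⟩
    obtain ⟨x, -, χ, hχ, hx⟩ := hK.tendsto_subseq (x := fun n => u (φ (ψ (ns n))) t) fun n => hu _ _
    refine ⟨χ, ?_⟩
    have hcomp : Tendsto (fun n => ns (χ n)) atTop atTop := hns.comp hχ.tendsto_atTop
    have h1 : ∀ n, D (w (Sum.inr (q n))) x ≤ ENNReal.ofReal (g t - g (q n)) := fun n => by
      have e1 : Tendsto (fun k => D (u (φ (ψ (ns (χ k)))) (q n)) (u (φ (ψ (ns (χ k)))) t)) atTop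
          (𝓝 (D (w (Sum.inr (q n))) x)) :=
        (hD.tendsto (w (Sum.inr (q n)), x)).comp
          (((hw (Sum.inr (q n))).comp hcomp).prodMk_nhds hx)
      have e2 : Tendsto (fun k => ENNReal.ofReal (f (φ (ψ (ns (χ k)))) t -
          f (φ (ψ (ns (χ k)))) (q n))) atTop (𝓝 (ENNReal.ofReal (g t - g (q n)))) :=
        (ENNReal.continuous_ofReal.tendsto _).comp
          (((hfg' t).comp hcomp).sub ((hfg' (q n)).comp hcomp))
      exact le_of_tendsto_of_tendsto' e1 e2 fun k => huf _ _ _ (hq2 n).le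
    have h2 : Tendsto (fun n => D (w (Sum.inr (q (θ n)))) x) atTop (𝓝 (D z x)) :=
      (hD.tendsto (z, x)).comp (hz.prodMk_nhds tendsto_const_nhds)
    have h3 : Tendsto (fun n => ENNReal.ofReal (g t - g (q (θ n)))) atTop (𝓝 0) := by
      have := (ENNReal.continuous_ofReal.tendsto _).comp
        ((tendsto_const_nhds (x := g t)).sub
          ((ht.tendsto.comp hqt).comp hθ.tendsto_atTop))
      simpa [Function.comp_def] using this
    have h4 : D z x = 0 := le_antisymm (le_of_tendsto_of_tendsto' h2 h3 fun n => h1 _) zero_le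
    rw [hD0 z x h4]
    exact hx
  choose v hv using hall
  exact ⟨φ ∘ ψ, g, v, hφ.comp hψ, hg, hfg', hv⟩

/-! ### Partitions and interpolants -/

namespace TimePartition

variable {T : ℝ} (P : TimePartition T)

/-- The index of the first node not before `t`. -/
noncomputable def index (t : ℝ) : ℕ := sInf {i : ℕ | t ≤ P.node i}

theorem node_le_node {i j : ℕ} (hij : i ≤ j) (hj : j ≤ P.num) : P.node i ≤ P.node j := by
  induction j, hij using Nat.le_induction with
  | base => exact le_rfl
  | succ k hk ih => exact (ih (by omega)).trans (P.node_lt k (by omega)).le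

theorem node_lt_node {i j : ℕ} (hij : i < j) (hj : j ≤ P.num) : P.node i < P.node j :=
  (P.node_lt i (by omega)).trans_le (P.node_le_node hij hj)

theorem node_nonneg {i : ℕ} (hi : i ≤ P.num) : 0 ≤ P.node i :=
  P.node_zero ▸ P.node_le_node (zero_le (a := i)) hi

theorem node_le {i : ℕ} (hi : i ≤ P.num) : P.node i ≤ T :=
  (P.node_le_node hi le_rfl).trans_eq P.node_num

theorem node_mem {i : ℕ} (hi : i ≤ P.num) : P.node i ∈ Icc 0 T := ⟨P.node_nonneg hi, P.node_le hi⟩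

theorem index_le_of_le {t : ℝ} {i : ℕ} (h : t ≤ P.node i) : P.index t ≤ i := Nat.sInf_le h

theorem lt_of_lt_index {t : ℝ} {i : ℕ} (h : i < P.index t) : P.node i < t :=
  not_le.1 fun h' => (P.index_le_of_le h').not_gt h

variable {t : ℝ}

theorem index_le (ht : t ≤ T) : P.index t ≤ P.num := P.index_le_of_le (ht.trans_eq P.node_num.symm)

theorem le_node_index (ht : t ≤ T) : t ≤ P.node (P.index t) :=
  Nat.sInf_mem (s := {i : ℕ | t ≤ P.node i}) ⟨P.num, ht.trans_eq P.node_num.symm⟩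

theorem index_mono {s : ℝ} (hst : s ≤ t) (ht : t ≤ T) : P.index s ≤ P.index t :=
  P.index_le_of_le (hst.trans (P.le_node_index ht))

theorem index_of_nonpos (ht : t ≤ 0) : P.index t = 0 :=
  Nat.le_zero.1 (P.index_le_of_le (ht.trans_eq P.node_zero.symm))

theorem index_eq_succ {i : ℕ} (hi : i < P.num) (h : P.node i < t) (h' : t ≤ P.node (i + 1)) :
    P.index t = i + 1 := by
  refine le_antisymm (P.index_le_of_le h') (not_lt.1 fun hlt => ?_)
  have h1 := P.le_node_index (h'.trans (P.node_le hi))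
  have h2 := P.node_le_node (Nat.lt_succ_iff.1 hlt) hi.le
  linarith

theorem index_node {i : ℕ} (hi : i ≤ P.num) : P.index (P.node i) = i := by
  refine le_antisymm (P.index_le_of_le le_rfl) (not_lt.1 fun hlt => ?_)
  have h1 := P.le_node_index (P.node_le hi)
  have h2 := P.node_lt_node hlt hi
  linarith

theorem sub_le_step {i : ℕ} (hi : i < P.num) : P.node (i + 1) - P.node i ≤ P.step :=
  le_ciSup (f := fun i : Fin P.num => P.node (i + 1) - P.node i) (finite_range _).bddAbove ⟨i, hi⟩

theorem step_nonneg : 0 ≤ P.step :=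
  Real.iSup_nonneg fun i => sub_nonneg.2 (P.node_lt i i.2).le

theorem node_index_le (h0 : 0 ≤ t) (ht : t ≤ T) : P.node (P.index t) ≤ t + P.step := by
  rcases Nat.eq_zero_or_pos (P.index t) with h | h
  · rw [h, P.node_zero]; linarith [P.step_nonneg]
  · have h1 := P.lt_of_lt_index (t := t) (i := P.index t - 1) (by omega)
    have h2 := P.sub_le_step (i := P.index t - 1) (by have := P.index_le ht; omega)
    rw [Nat.sub_add_cancel h] at h2
    linarith

theorem le_node_index_pred (h0 : 0 < t) (ht : t ≤ T) :
    t - P.step ≤ P.node (P.index t - 1) ∧ 0 < P.index t := by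
  have h1 := P.le_node_index ht
  have h : 0 < P.index t := Nat.pos_of_ne_zero fun h => by
    rw [h, P.node_zero] at h1; linarith
  have h2 := P.sub_le_step (i := P.index t - 1) (by have := P.index_le ht; omega)
  rw [Nat.sub_add_cancel h] at h2
  exact ⟨by linarith, h⟩

theorem index_pred_le (ht : t ≤ T) : P.index t - 1 ≤ P.num :=
  (Nat.sub_le _ _).trans (P.index_le ht)

theorem aemeasurable_index : AEMeasurable P.index (volume.restrict (Icc 0 T)) :=
  aemeasurable_restrict_of_monotoneOn measurableSet_Icc fun _ _ _ ht hst => P.index_mono hst ht.2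

/-- The index is monotone in time, and a countable family of continuous functions is jointly
measurable. -/
theorem aestronglyMeasurable_comp_index {f : ℕ → ℝ → ℝ} (hf : ∀ i, Continuous (f i)) {s : Set ℝ}
    (hs : s ⊆ Icc 0 T) : AEStronglyMeasurable (fun t => f (P.index t) t) (volume.restrict s) := by
  have h1 : Measurable (Function.uncurry f) :=
    measurable_from_prod_countable_right fun i => (hf i).measurable
  exact ((h1.comp_aemeasurable (P.aemeasurable_index.prodMk aemeasurable_id)).mono_measure
    (Measure.restrict_mono hs le_rfl)).aestronglyMeasurable

theorem integral_comp_index {f : ℕ → ℝ → ℝ} (hf : ∀ i, Continuous (f i)) {j : ℕ} (hj : j ≤ P.num) :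
    IntervalIntegrable (fun t => f (P.index t) t) volume 0 (P.node j) ∧
    ∫ t in (0 : ℝ)..P.node j, f (P.index t) t =
      ∑ i ∈ Finset.range j, ∫ t in P.node i..P.node (i + 1), f (i + 1) t := by
  induction j with
  | zero => simp [P.node_zero]
  | succ j ih =>
    obtain ⟨h1, h2⟩ := ih (by omega)
    have heq : ∀ t ∈ uIoc (P.node j) (P.node (j + 1)), f (P.index t) t = f (j + 1) t := by
      intro t ht
      rw [uIoc_of_le (P.node_lt j hj).le] at ht
      rw [P.index_eq_succ hj ht.1 ht.2]
    have h3 : IntervalIntegrable (fun t => f (P.index t) t) volume (P.node j) (P.node (j + 1)) :=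
      ((hf (j + 1)).intervalIntegrable _ _).congr fun t ht => (heq t ht).symm
    refine ⟨h1.trans h3, ?_⟩
    rw [← intervalIntegral.integral_add_adjacent_intervals h1 h3, h2, Finset.sum_range_succ,
      intervalIntegral.integral_congr_ae (Eventually.of_forall heq)]

/-- The uniform partition of `[0, T]` into `n + 1` intervals. -/
noncomputable def uniform (hT : 0 < T) (n : ℕ) : TimePartition T where
  num := n + 1
  node i := T / (n + 1) * i
  node_zero := by simp
  node_num := by push_cast; field_simp
  node_lt i _ := by
    have : 0 < T / ((n : ℝ) + 1) := by positivity
    push_cast; nlinarith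

theorem tendsto_step_uniform (hT : 0 < T) :
    Tendsto (fun n => (uniform hT n).step) atTop (𝓝 0) := by
  have h : ∀ n : ℕ, (uniform hT n).step ≤ T * (1 / ((n : ℝ) + 1)) := fun n => by
    refine Real.iSup_le (fun i => ?_) (by positivity)
    simp only [uniform]
    push_cast
    rw [mul_one_div]
    linarith
  refine squeeze_zero (fun n => (uniform hT n).step_nonneg) h ?_
  simpa using (tendsto_one_div_add_atTop_nhds_zero_nat (𝕜 := ℝ)).const_mul T

end TimePartition

section Interpolant

variable {Q : Type*} {T : ℝ} {D : Q → Q → ℝ≥0∞}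

theorem interpolant_eq (P : TimePartition T) (c : ℕ → Q) (t : ℝ) :
    interpolant P c t = c (P.index t) := rfl

theorem le_sum_Ico_of_triangle (hD0 : ∀ x, D x x = 0) (htri : ∀ x y z, D x z ≤ D x y + D y z)
    (c : ℕ → Q) {a b : ℕ} (hab : a ≤ b) :
    D (c a) (c b) ≤ ∑ i ∈ Finset.Ico a b, D (c i) (c (i + 1)) := by
  induction b, hab using Nat.le_induction with
  | base => simp [hD0]
  | succ b hb ih =>
    rw [Finset.sum_Ico_succ_top hb]
    exact (htri _ (c b) _).trans (add_le_add ih le_rfl)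

/-- By the triangle inequality no partition sees more than the successive jumps of `c`; the nodes
cut off at `t` see all of them. -/
theorem totalDiss_interpolant (hD0 : ∀ x, D x x = 0) (htri : ∀ x y z, D x z ≤ D x y + D y z)
    (P : TimePartition T) (c : ℕ → Q) {t : ℝ} (h0 : 0 ≤ t) (ht : t ≤ T) :
    totalDiss D (interpolant P c) t =
      ∑ i ∈ Finset.range (P.index t), D (c i) (c (i + 1)) := by
  refine le_antisymm (iSup₂_le ?_) ?_
  · rintro ⟨N, s, hs⟩ ⟨hs0, hsN⟩
    simp only at hs0 hsN ⊢
    have key : ∀ n ≤ N, ∑ i ∈ Finset.range n, D (interpolant P c (s i)) (interpolant P c (s (i + 1)))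
        ≤ ∑ i ∈ Finset.range (P.index (s n)), D (c i) (c (i + 1)) := by
      intro n
      induction n with
      | zero => intro _; simp
      | succ n ih =>
        intro hn
        have hle : P.index (s n) ≤ P.index (s (n + 1)) :=
          P.index_mono (hs n.le_succ) ((hs hn).trans (hsN.trans_le ht))
        rw [Finset.sum_range_succ, ← Finset.sum_range_add_sum_Ico _ hle]
        exact add_le_add (ih (by omega)) (le_sum_Ico_of_triangle hD0 htri c hle)
    have := key N le_rfl
    rwa [hsN] at this
  -- The index is capped because nodes beyond `num` are arbitrary. Capping the value at `t` makes
  -- the last point `t` itself, where the interpolant already has the value of its node.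
  · let s : ℕ → ℝ := fun i => min (P.node (min i P.num)) t
    have hs : Monotone s := fun i j hij => min_le_min_right _
      (P.node_le_node (min_le_min_right _ hij) (min_le_right _ _))
    have hidx := P.index_le ht
    have hsN : s (P.index t) = t := by
      simp only [s]
      rw [min_eq_left hidx, min_eq_right (P.le_node_index ht)]
    have hs0 : s 0 = 0 := by simp [s, P.node_zero, h0]
    have hc : ∀ i ≤ P.index t, interpolant P c (s i) = c i := fun i hi => by
      rcases hi.eq_or_lt with rfl | hlt
      · rw [hsN, interpolant_eq]
      · have : s i = P.node i := by
          simp only [s]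
          rw [min_eq_left (hi.trans hidx), min_eq_left (P.lt_of_lt_index hlt).le]
        rw [this, interpolant_eq, P.index_node (by omega)]
    refine le_trans (le_of_eq ?_) (le_iSup₂ (f := fun (p : ℕ × {s : ℕ → ℝ // Monotone s})
      (_ : p.2.1 0 = 0 ∧ p.2.1 p.1 = t) => ∑ i ∈ Finset.range p.1,
        D (interpolant P c (p.2.1 i)) (interpolant P c (p.2.1 (i + 1))))
      (P.index t, ⟨s, hs⟩) ⟨hs0, hsN⟩)
    refine Finset.sum_congr rfl fun i hi => ?_
    have := Finset.mem_range.1 hi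
    rw [hc i this.le, hc (i + 1) this]

theorem sum_le_totalDiss (q : ℝ → Q) (P : TimePartition T) :
    ∑ i ∈ Finset.range P.num, D (q (P.node i)) (q (P.node (i + 1))) ≤ totalDiss D q T := by
  let s : ℕ → ℝ := fun i => P.node (min i P.num)
  have hs : Monotone s := fun i j hij =>
    P.node_le_node (min_le_min_right _ hij) (min_le_right _ _)
  refine le_trans (le_of_eq ?_) (le_iSup₂ (f := fun (p : ℕ × {s : ℕ → ℝ // Monotone s})
      (_ : p.2.1 0 = 0 ∧ p.2.1 p.1 = T) => ∑ i ∈ Finset.range p.1,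
        D (q (p.2.1 i)) (q (p.2.1 (i + 1))))
      (P.num, ⟨s, hs⟩) ⟨by simp [s, P.node_zero], by simp [s, P.node_num]⟩)
  refine Finset.sum_congr rfl fun i hi => ?_
  have := Finset.mem_range.1 hi
  simp only [s]
  rw [min_eq_left this.le, min_eq_left (show i + 1 ≤ P.num from this)]

theorem totalDiss_le_of_le {q : ℝ → Q} {g : ℝ → ℝ} (hg : Monotone g) {t : ℝ}
    (h : ∀ a b, 0 ≤ a → a ≤ b → b ≤ t → D (q a) (q b) ≤ ENNReal.ofReal (g b - g a)) :
    totalDiss D q t ≤ ENNReal.ofReal (g t - g 0) := by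
  refine iSup₂_le ?_
  rintro ⟨N, s, hs⟩ ⟨hs0, hsN⟩
  simp only at hs0 hsN ⊢
  calc ∑ i ∈ Finset.range N, D (q (s i)) (q (s (i + 1)))
      ≤ ∑ i ∈ Finset.range N, ENNReal.ofReal (g (s (i + 1)) - g (s i)) := by
        refine Finset.sum_le_sum fun i hi => h _ _ ?_ (hs i.le_succ) ?_
        · rw [← hs0]; exact hs (Nat.zero_le i)
        · rw [← hsN]; exact hs (Finset.mem_range.1 hi)
    _ = ENNReal.ofReal (∑ i ∈ Finset.range N, (g (s (i + 1)) - g (s i))) :=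
        (ENNReal.ofReal_sum_of_nonneg fun i _ => sub_nonneg.2 (hg (hs i.le_succ))).symm
    _ = _ := by rw [Finset.sum_range_sub (fun i => g (s i)), hs0, hsN]

end Interpolant

/-! ### Energetic systems: incremental problems and a priori bounds -/

/-- The structural assumptions of the energetic theory on the energy `E = e + w` over `[0, T]`, with
power `p`, and on the dissipation metric `D`. -/
structure IsEnergeticSystem {Q : Type*} [TopologicalSpace Q] (T : ℝ) (e p : Q → ℝ → ℝ)
    (w : Q → ℝ≥0∞) (E : Q → ℝ → ℝ≥0∞) (D : Q → Q → ℝ≥0∞) : Prop where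
  pos : 0 < T
  energy_eq : ∀ q, ∀ t ∈ Icc 0 T, E q t = ENNReal.ofReal (e q t) + w q
  nonneg : ∀ q t, 0 ≤ e q t
  continuous_energy : Continuous (Function.uncurry e)
  continuous_power : Continuous (Function.uncurry p)
  hasDerivWithinAt : ∀ q, ∀ t ∈ Icc 0 T, HasDerivWithinAt (e q) (p q t) (Icc 0 T) t
  growth : ∃ c, 0 ≤ c ∧ ∀ q t, |p q t| ≤ c * (1 + e q t)
  isCompact_sublevel : ∀ a : ℝ, IsCompact {q | w q ≤ ENNReal.ofReal a}
  diss_self : ∀ x, D x x = 0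
  diss_triangle : ∀ x y z, D x z ≤ D x y + D y z
  diss_ne_top : ∀ x y, D x y ≠ ⊤
  continuous_diss : Continuous (Function.uncurry D)
  eq_of_diss_eq_zero : ∀ x y, D x y = 0 → x = y

namespace IsEnergeticSystem

variable {Q : Type*} [TopologicalSpace Q] {T : ℝ} {e p : Q → ℝ → ℝ}
  {w : Q → ℝ≥0∞} {E : Q → ℝ → ℝ≥0∞} {D : Q → Q → ℝ≥0∞} (h : IsEnergeticSystem T e p w E D)

include h

theorem continuous_power_apply (q : Q) : Continuous (p q) :=
  h.continuous_power.comp (continuous_const.prodMk continuous_id)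

theorem continuous_energy_apply (q : Q) : Continuous (e q) :=
  h.continuous_energy.comp (continuous_const.prodMk continuous_id)

theorem hasDerivAt (q : Q) {t : ℝ} (ht : t ∈ Ioo 0 T) : HasDerivAt (e q) (p q t) t :=
  (h.hasDerivWithinAt q t (Ioo_subset_Icc_self ht)).hasDerivAt (Icc_mem_nhds ht.1 ht.2)

theorem integral_power (q : Q) {s t : ℝ} (hs : 0 ≤ s) (hst : s ≤ t) (ht : t ≤ T) :
    ∫ x in s..t, p q x = e q t - e q s :=
  intervalIntegral.integral_eq_sub_of_hasDerivAt_of_le hst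
    (h.continuous_energy_apply q).continuousOn
    (fun _ hx => h.hasDerivAt q ⟨hs.trans_lt hx.1, hx.2.trans_le ht⟩)
    ((h.continuous_power_apply q).intervalIntegrable _ _)

theorem toReal_energy {q : Q} (hq : w q ≠ ⊤) {t : ℝ} (ht : t ∈ Icc 0 T) :
    (E q t).toReal = e q t + (w q).toReal := by
  rw [h.energy_eq q t ht, ENNReal.toReal_add ENNReal.ofReal_ne_top hq,
    ENNReal.toReal_ofReal (h.nonneg q t)]

theorem energy_ne_top {q : Q} (hq : w q ≠ ⊤) {t : ℝ} (ht : t ∈ Icc 0 T) : E q t ≠ ⊤ := by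
  rw [h.energy_eq q t ht]; exact ENNReal.add_ne_top.2 ⟨ENNReal.ofReal_ne_top, hq⟩

theorem hasDerivWithinAt_toReal {q : Q} (hq : w q ≠ ⊤) {t : ℝ} (ht : t ∈ Icc 0 T) :
    HasDerivWithinAt (fun s => (E q s).toReal) (p q t) (Icc 0 T) t :=
  ((h.hasDerivWithinAt q t ht).add_const (w q).toReal).congr
    (fun _ hs => h.toReal_energy hq hs) (h.toReal_energy hq ht)

theorem hasPowerAt {q : Q} (hq : w q ≠ ⊤) {t : ℝ} (ht : t ∈ Icc 0 T) : HasPowerAt T E q t :=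
  ⟨(h.energy_ne_top hq ht).lt_top, (h.hasDerivWithinAt_toReal hq ht).differentiableWithinAt⟩

theorem power_eq {q : Q} (hq : w q ≠ ⊤) {t : ℝ} (ht : t ∈ Icc 0 T) : power T E q t = p q t :=
  (h.hasDerivWithinAt_toReal hq ht).derivWithin (uniqueDiffOn_Icc h.pos t ht)

/-- Gronwall: `exp (-c x) (1 + e (q, x))` has nonpositive derivative. -/
theorem one_add_energy_le {c : ℝ} (hc : ∀ q t, |p q t| ≤ c * (1 + e q t)) (q : Q) {s t : ℝ}
    (hs : 0 ≤ s) (hst : s ≤ t) (ht : t ≤ T) :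
    1 + e q t ≤ Real.exp (c * (t - s)) * (1 + e q s) := by
  have hanti : AntitoneOn (fun x => Real.exp (-(c * x)) * (1 + e q x)) (Icc s t) := by
    have hd : ∀ x ∈ Ioo s t, HasDerivAt (fun x => Real.exp (-(c * x)) * (1 + e q x))
        (Real.exp (-(c * x)) * (-c) * (1 + e q x) + Real.exp (-(c * x)) * p q x) x := fun x hx => by
      have h1 : HasDerivAt (fun x => Real.exp (-(c * x))) (Real.exp (-(c * x)) * (-c)) x := by
        have := ((hasDerivAt_id x).const_mul c).neg.exp
        simpa using this
      exact h1.mul ((h.hasDerivAt q ⟨hs.trans_lt hx.1, hx.2.trans_le ht⟩).const_add 1)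
    refine antitoneOn_of_deriv_nonpos (convex_Icc _ _) ?_ ?_ ?_
    · have := h.continuous_energy_apply q
      fun_prop
    · rw [interior_Icc]
      exact fun x hx => (hd x hx).differentiableAt.differentiableWithinAt
    · rw [interior_Icc]
      intro x hx
      rw [(hd x hx).deriv]
      have h1 := (abs_le.1 (hc q x)).2
      have h2 := Real.exp_pos (-(c * x))
      nlinarith
  have h1 := hanti (left_mem_Icc.2 hst) (right_mem_Icc.2 hst) hst
  simp only at h1
  have h2 := mul_le_mul_of_nonneg_left h1 (Real.exp_pos (c * t)).le
  rw [← mul_assoc, ← mul_assoc, ← Real.exp_add, ← Real.exp_add, add_neg_cancel, Real.exp_zero,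
    one_mul] at h2
  rwa [mul_sub, sub_eq_add_neg]

theorem energy_add_one_le {c : ℝ} (hc0 : 0 ≤ c) (hc : ∀ q t, |p q t| ≤ c * (1 + e q t)) (q : Q)
    {s t : ℝ} (hs : 0 ≤ s) (hst : s ≤ t) (ht : t ≤ T) :
    E q t + 1 ≤ ENNReal.ofReal (Real.exp (c * (t - s))) * (E q s + 1) := by
  rw [h.energy_eq q t ⟨hs.trans hst, ht⟩, h.energy_eq q s ⟨hs, hst.trans ht⟩]
  have h1 : ENNReal.ofReal (1 + e q t) ≤
      ENNReal.ofReal (Real.exp (c * (t - s))) * ENNReal.ofReal (1 + e q s) := by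
    rw [← ENNReal.ofReal_mul (Real.exp_pos _).le]
    exact ENNReal.ofReal_le_ofReal (h.one_add_energy_le hc q hs hst ht)
  rw [ENNReal.ofReal_add zero_le_one (h.nonneg q t), ENNReal.ofReal_add zero_le_one (h.nonneg q s),
    ENNReal.ofReal_one] at h1
  have h2 : w q ≤ ENNReal.ofReal (Real.exp (c * (t - s))) * w q := by
    have : (1 : ℝ≥0∞) ≤ ENNReal.ofReal (Real.exp (c * (t - s))) := by
      rw [ENNReal.one_le_ofReal, Real.one_le_exp_iff]
      exact mul_nonneg hc0 (sub_nonneg.2 hst)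
    exact le_mul_of_one_le_left zero_le this
  calc ENNReal.ofReal (e q t) + w q + 1 = (1 + ENNReal.ofReal (e q t)) + w q := by ring
    _ ≤ ENNReal.ofReal (Real.exp (c * (t - s))) * (1 + ENNReal.ofReal (e q s)) +
        ENNReal.ofReal (Real.exp (c * (t - s))) * w q := add_le_add h1 h2
    _ = _ := by ring

theorem isCompact_sublevel' {a : ℝ≥0∞} (ha : a ≠ ⊤) : IsCompact {q | w q ≤ a} := by
  have := h.isCompact_sublevel a.toReal
  rwa [ENNReal.ofReal_toReal ha] at this

theorem lowerSemicontinuous [T2Space Q] : LowerSemicontinuous w := by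
  refine lowerSemicontinuous_iff_isClosed_preimage.2 fun a => ?_
  by_cases ha : a = ⊤
  · simp [ha]
  · exact (h.isCompact_sublevel' ha).isClosed

/-- The incremental minimization problems are solvable. -/
theorem exists_minimizer [T2Space Q] {t : ℝ} (ht : t ∈ Icc 0 T) (a : Q) :
    ∃ b, ∀ q, E b t + D a b ≤ E q t + D a q := by
  by_cases hfin : ∃ q₀, E q₀ t + D a q₀ ≠ ⊤
  swap
  · refine ⟨a, fun q => ?_⟩
    push Not at hfin
    rw [hfin q]; exact le_top
  obtain ⟨q₀, hq₀⟩ := hfin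
  have hle : ∀ q, w q ≤ E q t + D a q := fun q => by
    rw [h.energy_eq q t ht, add_right_comm]; exact le_add_self
  have hlsc : LowerSemicontinuous fun q => E q t + D a q := by
    have h1 : (fun q => E q t + D a q) = fun q => ENNReal.ofReal (e q t) + D a q + w q := by
      funext q; rw [h.energy_eq q t ht, add_right_comm]
    rw [h1]
    refine LowerSemicontinuous.add (Continuous.lowerSemicontinuous ?_) h.lowerSemicontinuous
    exact (ENNReal.continuous_ofReal.comp (h.continuous_energy.comp
      (continuous_id.prodMk continuous_const))).add
      (h.continuous_diss.comp (continuous_const.prodMk continuous_id))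
  -- Outside this compact sublevel of `w`, the functional already exceeds its value at the
  -- competitor `q₀`.
  obtain ⟨b, -, hb⟩ := (hlsc.lowerSemicontinuousOn _).exists_isMinOn
    (s := {q | w q ≤ E q₀ t + D a q₀}) ⟨q₀, hle q₀⟩ (h.isCompact_sublevel' hq₀)
  refine ⟨b, fun q => ?_⟩
  by_cases hq : w q ≤ E q₀ t + D a q₀
  · exact hb hq
  · exact (hb (hle q₀)).trans ((not_le.1 hq).le.trans (hle q))

theorem exists_incrementalSolution [T2Space Q] (P : TimePartition T) (q₀ : Q) :
    ∃ c : ℕ → Q, IsIncrementalSolution E D P q₀ c := by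
  have hstep : ∀ (i : ℕ) (a : Q), ∃ b, i < P.num → ∀ q, E b (P.node (i + 1)) + D a b ≤
      E q (P.node (i + 1)) + D a q := fun i a => by
    by_cases hi : i < P.num
    · obtain ⟨b, hb⟩ := h.exists_minimizer (P.node_mem hi) a
      exact ⟨b, fun _ => hb⟩
    · exact ⟨a, fun hi' => absurd hi' hi⟩
  choose F hF using hstep
  exact ⟨fun n => Nat.rec q₀ F n, rfl, fun i hi q => hF i _ hi q⟩

section Incremental

variable {P : TimePartition T} {q₀ : Q} {c : ℕ → Q} (hc : IsIncrementalSolution E D P q₀ c)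

include hc

theorem incremental_le {i : ℕ} (hi : i < P.num) :
    E (c (i + 1)) (P.node (i + 1)) + D (c i) (c (i + 1)) ≤ E (c i) (P.node (i + 1)) := by
  simpa [h.diss_self] using hc.2 i hi (c i)

theorem energy_incremental_le {C : ℝ} (hC0 : 0 ≤ C) (hC : ∀ q t, |p q t| ≤ C * (1 + e q t))
    {i : ℕ} (hi : i ≤ P.num) :
    E (c i) (P.node i) + 1 ≤ ENNReal.ofReal (Real.exp (C * P.node i)) * (E q₀ 0 + 1) := by
  induction i with
  | zero => rw [hc.1, P.node_zero]; simp
  | succ i ih =>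
    have h1 : E (c (i + 1)) (P.node (i + 1)) ≤ E (c i) (P.node (i + 1)) :=
      le_self_add.trans (h.incremental_le hc hi)
    have h2 := h.energy_add_one_le hC0 hC (c i) (P.node_nonneg (by omega)) (P.node_lt i hi).le
      (P.node_le hi)
    refine (add_le_add h1 le_rfl).trans (h2.trans ?_)
    refine (mul_le_mul_right (ih (by omega)) _).trans_eq ?_
    rw [← mul_assoc, ← ENNReal.ofReal_mul (Real.exp_pos _).le, ← Real.exp_add]
    congr 3; ring

theorem plastic_incremental_le {C : ℝ} (hC0 : 0 ≤ C) (hC : ∀ q t, |p q t| ≤ C * (1 + e q t))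
    {i : ℕ} (hi : i ≤ P.num) :
    w (c i) ≤ ENNReal.ofReal (Real.exp (C * T)) * (E q₀ 0 + 1) := by
  have h1 := h.energy_incremental_le hc hC0 hC hi
  rw [h.energy_eq _ _ (P.node_mem hi)] at h1
  calc w (c i) ≤ ENNReal.ofReal (e (c i) (P.node i)) + w (c i) + 1 := le_add_self.trans le_self_add
    _ ≤ _ := h1
    _ ≤ _ := by
      gcongr
      exact P.node_le hi

/-- Minimality and the triangle inequality through `c i`; the common term `D (c i) (c (i + 1))`
cancels because it is finite. At index `0` this is the assumed stability of the initial state. -/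
theorem stable_incremental {i : ℕ} (hi : i ≤ P.num) (hfin : w (c i) ≠ ⊤)
    (h0 : q₀ ∈ stableStates E D 0) : c i ∈ stableStates E D (P.node i) := by
  refine ⟨(h.energy_ne_top hfin (P.node_mem hi)).lt_top, fun q => ?_⟩
  cases i with
  | zero => rw [hc.1, P.node_zero]; exact h0.2 q
  | succ i =>
    have h1 := hc.2 i hi q
    have h2 := h.diss_triangle (c i) (c (i + 1)) q
    refine (ENNReal.add_le_add_iff_right (h.diss_ne_top (c i) (c (i + 1)))).1 ?_
    calc _ ≤ _ := h1
      _ ≤ E q (P.node (i + 1)) + (D (c i) (c (i + 1)) + D (c (i + 1)) q) := by gcongr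
      _ = _ := by ring

/-- Each step is tested with the previous state, so on each interval the power is that of the state
at its left end. -/
theorem incremental_energy_estimate (hfin : ∀ i ≤ P.num, w (c i) ≠ ⊤) {j : ℕ} (hj : j ≤ P.num) :
    (E (c j) (P.node j)).toReal + (∑ i ∈ Finset.range j, D (c i) (c (i + 1))).toReal ≤
      (E q₀ 0).toReal + ∑ i ∈ Finset.range j, ∫ s in P.node i..P.node (i + 1), p (c i) s := by
  induction j with
  | zero => rw [hc.1, P.node_zero]; simp
  | succ j ih =>
    have h1 := ih (by omega)
    have hmem : P.node (j + 1) ∈ Icc 0 T := P.node_mem hj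
    have h2 := ENNReal.toReal_mono (h.energy_ne_top (hfin j (by omega)) hmem) (h.incremental_le hc hj)
    rw [ENNReal.toReal_add (h.energy_ne_top (hfin _ hj) hmem) (h.diss_ne_top _ _),
      h.toReal_energy (hfin j (by omega)) hmem] at h2
    rw [h.toReal_energy (hfin j (by omega)) (P.node_mem (by omega))] at h1
    rw [Finset.sum_range_succ, Finset.sum_range_succ, ENNReal.toReal_add
      (ENNReal.sum_ne_top.2 fun i _ => h.diss_ne_top _ _) (h.diss_ne_top _ _),
      h.integral_power (c j) (P.node_nonneg (by omega)) (P.node_lt j hj).le (P.node_le hj)]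
    linarith

end Incremental

end IsEnergeticSystem

/-! ### Energetic systems: passage to the limit of vanishing time step -/

namespace IsEnergeticSystem

variable {Q : Type*} [TopologicalSpace Q] [T2Space Q] [FirstCountableTopology Q]
  {T : ℝ} {e p : Q → ℝ → ℝ}
  {w : Q → ℝ≥0∞} {E : Q → ℝ → ℝ≥0∞} {D : Q → Q → ℝ≥0∞}

omit [T2Space Q] [FirstCountableTopology Q] in
theorem diss_le_ofReal_sub (h : IsEnergeticSystem T e p w E D) (c : ℕ → Q) {a b : ℕ} (hab : a ≤ b) :
    D (c a) (c b) ≤ ENNReal.ofReal ((∑ i ∈ Finset.range b, D (c i) (c (i + 1))).toReal -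
      (∑ i ∈ Finset.range a, D (c i) (c (i + 1))).toReal) := by
  have hne : ∀ s : Finset ℕ, ∑ i ∈ s, D (c i) (c (i + 1)) ≠ ⊤ := fun s =>
    ENNReal.sum_ne_top.2 fun i _ => h.diss_ne_top _ _
  rw [← Finset.sum_range_add_sum_Ico _ hab, ENNReal.toReal_add (hne _) (hne _), add_sub_cancel_left,
    ENNReal.ofReal_toReal (hne _)]
  exact le_sum_Ico_of_triangle h.diss_self h.diss_triangle c hab

/-- A family of incremental solutions with values in a compact set of finite energy on which the
power is bounded, whose interpolants and dissipations converge pointwise as the time step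
vanishes. -/
structure IsConvergent (p : Q → ℝ → ℝ) (w : Q → ℝ≥0∞) (E : Q → ℝ → ℝ≥0∞) (D : Q → Q → ℝ≥0∞)
    (K : Set Q) (M : ℝ) (q₀ : Q) (P : ℕ → TimePartition T) (c : ℕ → ℕ → Q) (g : ℝ → ℝ)
    (v : ℝ → Q) : Prop where
  isCompact : IsCompact K
  ne_top : ∀ q ∈ K, w q ≠ ⊤
  power_le : ∀ q ∈ K, ∀ t ∈ Icc 0 T, |p q t| ≤ M
  stable : q₀ ∈ stableStates E D 0
  step : Tendsto (fun k => (P k).step) atTop (𝓝 0)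
  incremental : ∀ k, IsIncrementalSolution E D (P k) q₀ (c k)
  mem : ∀ k, ∀ i ≤ (P k).num, c k i ∈ K
  monotone : Monotone g
  tendsto_diss : ∀ t ∈ Icc 0 T, Tendsto (fun k => (totalDiss D (interpolant (P k) (c k)) t).toReal)
    atTop (𝓝 (g t))
  tendsto : ∀ t ∈ Icc 0 T, Tendsto (fun k => interpolant (P k) (c k) t) atTop (𝓝 (v t))

variable {K : Set Q} {M : ℝ} {q₀ : Q} {P : ℕ → TimePartition T} {c : ℕ → ℕ → Q} {g : ℝ → ℝ}
    {v : ℝ → Q}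

section

variable (h : IsEnergeticSystem T e p w E D) (hc : IsConvergent p w E D K M q₀ P c g v)

omit [FirstCountableTopology Q] [T2Space Q] in
include hc in
theorem interpolant_mem {t : ℝ} (ht : t ∈ Icc 0 T) (k : ℕ) : interpolant (P k) (c k) t ∈ K :=
  hc.mem k _ ((P k).index_le ht.2)

omit [FirstCountableTopology Q] in
include hc in
theorem limit_mem {t : ℝ} (ht : t ∈ Icc 0 T) : v t ∈ K :=
  hc.isCompact.isClosed.mem_of_tendsto (hc.tendsto t ht) (Eventually.of_forall (interpolant_mem hc ht))

omit [T2Space Q] [FirstCountableTopology Q] in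
include hc in
theorem tendsto_node_index {t : ℝ} (ht : t ∈ Icc 0 T) :
    Tendsto (fun k => (P k).node ((P k).index t)) atTop (𝓝 t) := by
  refine tendsto_of_tendsto_of_tendsto_of_le_of_le tendsto_const_nhds
    (by simpa using (tendsto_const_nhds (x := t)).add hc.step)
    (fun k => (P k).le_node_index ht.2) fun k => (P k).node_index_le ht.1 ht.2

omit [FirstCountableTopology Q] in
include h hc in
-- The interpolant at `t` is stable at the node `τ k ≥ t`, and `τ k → t`. In the stability
-- inequality the left side is lower semicontinuous and the right side converges. Tested with `v t`
-- itself, where `D` tends to `0`, it gives the upper bound for `w`; lower semicontinuity is the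
-- other half.
theorem stable_and_tendsto {t : ℝ} (ht : t ∈ Icc 0 T) :
    v t ∈ stableStates E D t ∧
      Tendsto (fun k => w (interpolant (P k) (c k) t)) atTop (𝓝 (w (v t))) := by
  set u : ℕ → Q := fun k => interpolant (P k) (c k) t with hu
  set τ : ℕ → ℝ := fun k => (P k).node ((P k).index t) with hτ
  have hut : Tendsto u atTop (𝓝 (v t)) := hc.tendsto t ht
  have hτt : Tendsto τ atTop (𝓝 t) := tendsto_node_index hc ht
  have hτm : ∀ k, τ k ∈ Icc 0 T := fun k => (P k).node_mem ((P k).index_le ht.2)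
  have hvw : w (v t) ≠ ⊤ := hc.ne_top _ (limit_mem hc ht)
  have hcont : Continuous fun x : Q × ℝ => ENNReal.ofReal (e x.1 x.2) :=
    ENNReal.continuous_ofReal.comp h.continuous_energy
  have hstab : ∀ k b, ENNReal.ofReal (e (u k) (τ k)) + w (u k) ≤
      ENNReal.ofReal (e b (τ k)) + w b + D (u k) b := fun k b => by
    have := (h.stable_incremental (hc.incremental k) ((P k).index_le ht.2)
      (hc.ne_top _ (interpolant_mem hc ht k)) hc.stable).2 b
    rwa [h.energy_eq _ _ (hτm k), h.energy_eq _ _ (hτm k)] at this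
  have hlim : ∀ b, Tendsto (fun k => ENNReal.ofReal (e b (τ k)) + w b + D (u k) b) atTop
      (𝓝 (ENNReal.ofReal (e b t) + w b + D (v t) b)) := fun b =>
    (((hcont.tendsto (b, t)).comp (tendsto_const_nhds.prodMk_nhds hτt)).add
      tendsto_const_nhds).add ((h.continuous_diss.tendsto (v t, b)).comp
        (hut.prodMk_nhds tendsto_const_nhds))
  have hlsc : LowerSemicontinuous fun x : Q × ℝ => ENNReal.ofReal (e x.1 x.2) + w x.1 :=
    hcont.lowerSemicontinuous.add (h.lowerSemicontinuous.comp continuous_fst)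
  refine ⟨⟨(h.energy_ne_top hvw ht).lt_top, fun b => ?_⟩, ?_⟩
  · rw [h.energy_eq _ _ ht, h.energy_eq _ _ ht]
    refine le_of_forall_lt fun y hy => ?_
    obtain ⟨y', hy', hy''⟩ := exists_between hy
    refine hy'.trans_le (ge_of_tendsto (hlim b) ?_)
    filter_upwards [(hut.prodMk_nhds hτt).eventually (hlsc (v t, t) y' hy'')] with k hk
    exact hk.le.trans (hstab k b)
  · refine tendsto_order.2 ⟨fun y hy => hut.eventually (h.lowerSemicontinuous (v t) y hy),
      fun y hy => ?_⟩
    have h1 : Tendsto (fun k => ENNReal.ofReal (e (v t) (τ k)) + w (v t) + D (u k) (v t) -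
        ENNReal.ofReal (e (u k) (τ k))) atTop (𝓝 (w (v t))) := by
      have := ENNReal.Tendsto.sub (hlim (v t))
        ((hcont.tendsto (v t, t)).comp (hut.prodMk_nhds hτt)) (Or.inr ENNReal.ofReal_ne_top)
      rwa [h.diss_self, add_zero, ENNReal.add_sub_cancel_left ENNReal.ofReal_ne_top] at this
    filter_upwards [h1.eventually (gt_mem_nhds hy)] with k hk
    exact (ENNReal.le_sub_of_add_le_left ENNReal.ofReal_ne_top (hstab k (v t))).trans_lt hk

omit [FirstCountableTopology Q] in
include h hc in
theorem tendsto_energy {t : ℝ} (ht : t ∈ Icc 0 T) {τ : ℕ → ℝ} (hτ : Tendsto τ atTop (𝓝 t))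
    (hτm : ∀ k, τ k ∈ Icc 0 T) :
    Tendsto (fun k => E (interpolant (P k) (c k) t) (τ k)) atTop (𝓝 (E (v t) t)) := by
  have hcont : Continuous fun x : Q × ℝ => ENNReal.ofReal (e x.1 x.2) :=
    ENNReal.continuous_ofReal.comp h.continuous_energy
  rw [h.energy_eq _ _ ht]
  simp only [fun k => h.energy_eq (interpolant (P k) (c k) t) (τ k) (hτm k)]
  exact ((hcont.tendsto (v t, t)).comp ((hc.tendsto t ht).prodMk_nhds hτ)).add
    (stable_and_tendsto h hc ht).2

omit [T2Space Q] [FirstCountableTopology Q] in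
include h in
theorem diss_interpolant_le {s t : ℝ} (hs : 0 ≤ s) (hst : s ≤ t) (ht : t ≤ T) (k : ℕ) :
    D (interpolant (P k) (c k) s) (interpolant (P k) (c k) t) ≤
      ENNReal.ofReal ((totalDiss D (interpolant (P k) (c k)) t).toReal -
        (totalDiss D (interpolant (P k) (c k)) s).toReal) := by
  rw [totalDiss_interpolant h.diss_self h.diss_triangle _ _ hs (hst.trans ht),
    totalDiss_interpolant h.diss_self h.diss_triangle _ _ (hs.trans hst) ht]
  exact h.diss_le_ofReal_sub _ ((P k).index_mono hst ht)

omit [T2Space Q] [FirstCountableTopology Q] in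
include h hc in
theorem diss_limit_le {s t : ℝ} (hs : 0 ≤ s) (hst : s ≤ t) (ht : t ≤ T) :
    D (v s) (v t) ≤ ENNReal.ofReal (g t - g s) := by
  have hsm : s ∈ Icc 0 T := ⟨hs, hst.trans ht⟩
  have htm : t ∈ Icc 0 T := ⟨hs.trans hst, ht⟩
  have h1 := (h.continuous_diss.tendsto (v s, v t)).comp
    ((hc.tendsto s hsm).prodMk_nhds (hc.tendsto t htm))
  have h2 := (ENNReal.continuous_ofReal.tendsto _).comp
    ((hc.tendsto_diss t htm).sub (hc.tendsto_diss s hsm))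
  exact le_of_tendsto_of_tendsto' h1 h2 fun k => diss_interpolant_le h hs hst ht k

omit [T2Space Q] [FirstCountableTopology Q] in
include h hc in
theorem tendsto_integral_power {x : ℕ → ℝ → Q} {y : ℝ → Q} {t : ℝ} (ht : t ∈ Icc 0 T)
    (hx : ∀ k, ∀ s ∈ Icc 0 t, x k s ∈ K)
    (hmeas : ∀ k, AEStronglyMeasurable (fun s => p (x k s) s) (volume.restrict (Icc 0 t)))
    (hlim : ∀ᵐ s, s ∈ Ioo 0 t → Tendsto (fun k => x k s) atTop (𝓝 (y s))) :
    Tendsto (fun k => ∫ s in (0 : ℝ)..t, p (x k s) s) atTop (𝓝 (∫ s in (0 : ℝ)..t, p (y s) s)) := by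
  refine intervalIntegral.tendsto_integral_filter_of_dominated_convergence (fun _ => M)
    (Eventually.of_forall fun k => ?_) (Eventually.of_forall fun k => Eventually.of_forall fun s hs =>
      ?_) intervalIntegrable_const ?_
  · rw [uIoc_of_le ht.1]
    exact (hmeas k).mono_measure (Measure.restrict_mono Ioc_subset_Icc_self le_rfl)
  · rw [uIoc_of_le ht.1] at hs
    rw [Real.norm_eq_abs]
    exact hc.power_le _ (hx k s ⟨hs.1.le, hs.2⟩) _ ⟨hs.1.le, hs.2.trans ht.2⟩
  · filter_upwards [hlim, Measure.ae_ne volume t] with s hs hst hs'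
    rw [uIoc_of_le ht.1] at hs'
    exact (h.continuous_power.tendsto (y s, s)).comp
      ((hs ⟨hs'.1, hs'.2.lt_of_ne hst⟩).prodMk_nhds tendsto_const_nhds)

omit [T2Space Q] [FirstCountableTopology Q] in
include h in
theorem aestronglyMeasurable_power (R : TimePartition T) (x : ℕ → Q) {S : Set ℝ}
    (hS : S ⊆ Icc 0 T) :
    AEStronglyMeasurable (fun s => p (x (R.index s)) s) (volume.restrict S) :=
  R.aestronglyMeasurable_comp_index (f := fun i s => p (x i) s)
    (fun i => h.continuous_power_apply (x i)) hS

omit [T2Space Q] [FirstCountableTopology Q] in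
include h hc in
theorem aestronglyMeasurable_limit :
    AEStronglyMeasurable (fun s => p (v s) s) (volume.restrict (Icc 0 T)) := by
  refine aestronglyMeasurable_of_tendsto_ae atTop
    (f := fun k s => p (interpolant (P k) (c k) s) s)
    (fun k => h.aestronglyMeasurable_power (P k) (c k) subset_rfl) ?_
  refine ae_restrict_of_forall_mem measurableSet_Icc fun s hs => ?_
  exact (h.continuous_power.tendsto (v s, s)).comp
    ((hc.tendsto s hs).prodMk_nhds tendsto_const_nhds)

omit [T2Space Q] in
include h hc in
-- Once the time step is below `s - s'`, the last jump before `s` is bounded by the dissipation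
-- between `s'` and `s`, which tends to `g s - g s'`. Continuity of `g` makes this small, and `D` is
-- definite on a compact set.
theorem tendsto_previous {s : ℝ} (hs : 0 < s) (hsT : s ≤ T) (hcont : ContinuousAt g s) :
    Tendsto (fun k => c k ((P k).index s - 1)) atTop (𝓝 (v s)) := by
  have hsm : s ∈ Icc 0 T := ⟨hs.le, hsT⟩
  have h1 : Tendsto (fun k => D (c k ((P k).index s - 1)) (interpolant (P k) (c k) s)) atTop
      (𝓝 0) := by
    refine ENNReal.tendsto_nhds_zero.2 fun ε hε => ?_
    obtain ⟨s', hs', hs's, hε'⟩ : ∃ s', 0 < s' ∧ s' < s ∧ ENNReal.ofReal (g s - g s') < ε := by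
      have h2 : Tendsto (fun x => ENNReal.ofReal (g s - g x)) (𝓝 s) (𝓝 0) := by
        have := (ENNReal.continuous_ofReal.tendsto _).comp
          ((tendsto_const_nhds (x := g s)).sub hcont.tendsto)
        simpa [Function.comp_def] using this
      have h3 : ∀ᶠ x in 𝓝[<] s, ENNReal.ofReal (g s - g x) < ε :=
        nhdsWithin_le_nhds (h2.eventually (gt_mem_nhds hε))
      have h4 : ∀ᶠ x in 𝓝[<] s, 0 < x := nhdsWithin_le_nhds (lt_mem_nhds hs)
      obtain ⟨x, hx⟩ := (h3.and (h4.and self_mem_nhdsWithin)).exists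
      exact ⟨x, hx.2.1, hx.2.2, hx.1⟩
    have hs'm : s' ∈ Icc 0 T := ⟨hs'.le, hs's.le.trans hsT⟩
    have h5 := (ENNReal.continuous_ofReal.tendsto _).comp
      ((hc.tendsto_diss s hsm).sub (hc.tendsto_diss s' hs'm))
    filter_upwards [h5.eventually (gt_mem_nhds hε'),
      hc.step.eventually (gt_mem_nhds (sub_pos.2 hs's))] with k hk1 hk2
    obtain ⟨h6, h7⟩ := (P k).le_node_index_pred hs hsT
    have h8 : (P k).index s' ≤ (P k).index s - 1 := (P k).index_le_of_le (by linarith)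
    refine le_trans ?_ hk1.le
    refine (h.diss_le_ofReal_sub (c k) (Nat.sub_le ((P k).index s) 1)).trans ?_
    simp only [Function.comp]
    rw [totalDiss_interpolant h.diss_self h.diss_triangle _ _ hs.le hsT,
      totalDiss_interpolant h.diss_self h.diss_triangle _ _ hs'.le hs'm.2]
    refine ENNReal.ofReal_le_ofReal (sub_le_sub_left (ENNReal.toReal_mono
      (ENNReal.sum_ne_top.2 fun i _ => h.diss_ne_top _ _)
      (Finset.sum_le_sum_of_subset (Finset.range_mono h8))) _)
  refine tendsto_of_tendsto_zero hc.isCompact h.continuous_diss h.eq_of_diss_eq_zero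
    (Eventually.of_forall fun k => hc.mem k _ ((P k).index_pred_le hsT)) ?_
  have h2 : Tendsto (fun k => D (interpolant (P k) (c k) s) (v s)) atTop (𝓝 0) := by
    have := (h.continuous_diss.tendsto (v s, v s)).comp
      ((hc.tendsto s hsm).prodMk_nhds tendsto_const_nhds)
    rwa [Function.uncurry_apply_pair, h.diss_self] at this
  refine tendsto_of_tendsto_of_tendsto_of_le_of_le tendsto_const_nhds
    (by simpa using h1.add h2) (fun _ => zero_le) fun k => h.diss_triangle _ _ _

include h hc in
-- Limit of the discrete energy inequality at the node `τ k`. The previous states converge to `v`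
-- off the countable set of jumps of `g`, and the overshoot from `t` to `τ k` costs at most `M (τ k
-- - t)`.
theorem energy_upper_estimate {t : ℝ} (ht : t ∈ Icc 0 T) :
    (E (v t) t).toReal + g t ≤ (E q₀ 0).toReal + ∫ s in (0 : ℝ)..t, p (v s) s := by
  set τ : ℕ → ℝ := fun k => (P k).node ((P k).index t) with hτ
  have hτt : Tendsto τ atTop (𝓝 t) := tendsto_node_index hc ht
  have hτm : ∀ k, τ k ∈ Icc 0 T := fun k => (P k).node_mem ((P k).index_le ht.2)
  have hvE : E (v t) t ≠ ⊤ := h.energy_ne_top (hc.ne_top _ (limit_mem hc ht)) ht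
  have hL : Tendsto (fun k => (E (interpolant (P k) (c k) t) (τ k)).toReal +
      (totalDiss D (interpolant (P k) (c k)) t).toReal) atTop (𝓝 ((E (v t) t).toReal + g t)) :=
    ((ENNReal.tendsto_toReal hvE).comp (tendsto_energy h hc ht hτt hτm)).add (hc.tendsto_diss t ht)
  have hint : Tendsto (fun k => ∫ s in (0 : ℝ)..t, p (c k ((P k).index s - 1)) s) atTop
      (𝓝 (∫ s in (0 : ℝ)..t, p (v s) s)) := by
    refine tendsto_integral_power h hc ht
      (fun k s hs => hc.mem k _ ((P k).index_pred_le (hs.2.trans ht.2)))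
      (fun k => h.aestronglyMeasurable_power (P k) (fun i => c k (i - 1))
        (Icc_subset_Icc_right ht.2)) ?_
    filter_upwards [hc.monotone.countable_not_continuousAt.ae_notMem volume] with s hs hst
    exact tendsto_previous h hc hst.1 (hst.2.le.trans ht.2) (not_not.1 hs)
  have hR : Tendsto (fun k => (E q₀ 0).toReal +
      ((∫ s in (0 : ℝ)..t, p (c k ((P k).index s - 1)) s) + M * (τ k - t))) atTop
      (𝓝 ((E q₀ 0).toReal + ∫ s in (0 : ℝ)..t, p (v s) s)) := by
    have := tendsto_const_nhds (x := (E q₀ 0).toReal) |>.add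
      (hint.add ((hτt.sub (tendsto_const_nhds (x := t))).const_mul M))
    simpa using this
  refine le_of_tendsto_of_tendsto' hL hR fun k => ?_
  have hidx := (P k).index_le ht.2
  have h1 := h.incremental_energy_estimate (hc.incremental k)
    (fun i hi => hc.ne_top _ (hc.mem k i hi)) hidx
  -- The shift by one selects the left-end state; the truncated value at index `0` does not enter
  -- the sum.
  obtain ⟨hii, hie⟩ := (P k).integral_comp_index (f := fun i s => p (c k (i - 1)) s)
    (fun i => h.continuous_power_apply _) hidx
  simp only [Nat.add_sub_cancel] at hie
  rw [← hie, ← totalDiss_interpolant h.diss_self h.diss_triangle (P k) (c k) ht.1 ht.2] at h1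
  refine h1.trans (add_le_add le_rfl ?_)
  have htτ : t ≤ τ k := (P k).le_node_index ht.2
  have hi1 : IntervalIntegrable (fun s => p (c k ((P k).index s - 1)) s) volume 0 t :=
    hii.mono_set (by rw [uIcc_of_le ht.1, uIcc_of_le (hτm k).1]; exact Icc_subset_Icc_right htτ)
  have hi2 : IntervalIntegrable (fun s => p (c k ((P k).index s - 1)) s) volume t (τ k) :=
    hii.mono_set (by rw [uIcc_of_le htτ, uIcc_of_le (hτm k).1]; exact Icc_subset_Icc_left ht.1)
  rw [← intervalIntegral.integral_add_adjacent_intervals hi1 hi2]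
  refine add_le_add le_rfl ?_
  have h3 := intervalIntegral.norm_integral_le_of_norm_le_const (C := M)
    (f := fun s => p (c k ((P k).index s - 1)) s) (a := t) (b := τ k) fun s hs => by
      rw [uIoc_of_le htτ] at hs
      have hsT : s ≤ T := hs.2.trans (hτm k).2
      exact hc.power_le _ (hc.mem k _ ((P k).index_pred_le hsT)) _ ⟨ht.1.trans hs.1.le, hsT⟩
  rw [abs_of_nonneg (sub_nonneg.2 htτ)] at h3
  exact (le_abs_self _).trans h3

include h hc in
-- Stability of `v` at each node of a partition, tested with its value at the next node, telescopes
-- to the inequality with the power taken at right-end states. Refining the partition, these states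
-- converge to `v s` wherever `g` is continuous.
theorem energy_lower_estimate {t : ℝ} (ht : t ∈ Icc 0 T) (hfin : totalDiss D v t ≠ ⊤) :
    (E (v 0) 0).toReal + ∫ s in (0 : ℝ)..t, p (v s) s ≤
      (E (v t) t).toReal + (totalDiss D v t).toReal := by
  rcases ht.1.eq_or_lt with rfl | h0
  · simp
  have hw : ∀ s ∈ Icc 0 T, w (v s) ≠ ⊤ := fun s hs => hc.ne_top _ (limit_mem hc hs)
  let U : ℕ → TimePartition t := TimePartition.uniform h0
  have hUm : ∀ n, ∀ i ≤ (U n).num, (U n).node i ∈ Icc 0 T := fun n i hi =>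
    ⟨(U n).node_nonneg hi, ((U n).node_le hi).trans ht.2⟩
  have hstep : Tendsto (fun n => (U n).step) atTop (𝓝 0) := TimePartition.tendsto_step_uniform h0
  have hint : Tendsto (fun n => ∫ s in (0 : ℝ)..t, p (v ((U n).node ((U n).index s))) s) atTop
      (𝓝 (∫ s in (0 : ℝ)..t, p (v s) s)) := by
    refine tendsto_integral_power h hc ht
      (fun n s hs => limit_mem hc (hUm n _ ((U n).index_le hs.2)))
      (fun n => (U n).aestronglyMeasurable_comp_index (f := fun i s => p (v ((U n).node i)) s)
        (fun i => h.continuous_power_apply _) subset_rfl) ?_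
    filter_upwards [hc.monotone.countable_not_continuousAt.ae_notMem volume] with s hs hst
    have hsm : s ∈ Icc 0 T := ⟨hst.1.le, hst.2.le.trans ht.2⟩
    have hnode : Tendsto (fun n => (U n).node ((U n).index s)) atTop (𝓝 s) :=
      tendsto_of_tendsto_of_tendsto_of_le_of_le tendsto_const_nhds
        (by simpa using (tendsto_const_nhds (x := s)).add hstep)
        (fun n => (U n).le_node_index hst.2.le) fun n => (U n).node_index_le hst.1.le hst.2.le
    have hmem : ∀ n, (U n).node ((U n).index s) ∈ Icc 0 T := fun n =>
      hUm n _ ((U n).index_le hst.2.le)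
    -- The arguments are swapped because the available bound is on `D` from `v s` to the later
    -- state, and `D` is not assumed symmetric.
    refine tendsto_of_tendsto_zero (D := fun x y => D y x) hc.isCompact
      (h.continuous_diss.comp continuous_swap) (fun x y hxy => (h.eq_of_diss_eq_zero y x hxy).symm)
      (Eventually.of_forall fun n => limit_mem hc (hmem n)) ?_
    have hg : Tendsto (fun n => ENNReal.ofReal (g ((U n).node ((U n).index s)) - g s)) atTop
        (𝓝 0) := by
      have := (ENNReal.continuous_ofReal.tendsto _).comp
        (((not_not.1 hs).tendsto.comp hnode).sub (tendsto_const_nhds (x := g s)))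
      simpa [Function.comp_def] using this
    exact tendsto_of_tendsto_of_tendsto_of_le_of_le tendsto_const_nhds hg (fun _ => zero_le)
      fun n => diss_limit_le h hc hst.1.le ((U n).le_node_index hst.2.le) (hmem n).2
  refine le_of_tendsto' (tendsto_const_nhds.add hint) fun n => ?_
  have key : ∀ j ≤ (U n).num, (E (v 0) 0).toReal +
      ∑ i ∈ Finset.range j, ∫ s in (U n).node i..(U n).node (i + 1), p (v ((U n).node (i + 1))) s ≤
      (E (v ((U n).node j)) ((U n).node j)).toReal +
        (∑ i ∈ Finset.range j, D (v ((U n).node i)) (v ((U n).node (i + 1)))).toReal := by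
    intro j
    induction j with
    | zero => intro _; simp [(U n).node_zero]
    | succ j ih =>
      intro hj
      have h1 := ih (by omega)
      have hm := hUm n j (by omega)
      have hm' := hUm n (j + 1) hj
      have h2 := (stable_and_tendsto h hc hm).1.2 (v ((U n).node (j + 1)))
      have h3 := ENNReal.toReal_mono (ENNReal.add_ne_top.2 ⟨h.energy_ne_top (hw _ hm') hm,
        h.diss_ne_top _ _⟩) h2
      rw [ENNReal.toReal_add (h.energy_ne_top (hw _ hm') hm) (h.diss_ne_top _ _),
        h.toReal_energy (hw _ hm') hm] at h3
      rw [Finset.sum_range_succ, Finset.sum_range_succ, ENNReal.toReal_add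
        (ENNReal.sum_ne_top.2 fun i _ => h.diss_ne_top _ _) (h.diss_ne_top _ _),
        h.integral_power _ hm.1 ((U n).node_lt j hj).le hm'.2, h.toReal_energy (hw _ hm') hm']
      linarith
  have h1 := key _ le_rfl
  have h2 := ((U n).integral_comp_index (f := fun i s => p (v ((U n).node i)) s)
    (fun i => h.continuous_power_apply _) le_rfl).2
  rw [← h2, (U n).node_num] at h1
  exact h1.trans (add_le_add le_rfl (ENNReal.toReal_mono hfin (sum_le_totalDiss v (U n))))

include h hc in
/-- The limit of incremental solutions is an energetic solution; dissipations, energies and powers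
converge as well. -/
theorem limit_isEnergeticSolution :
    IsEnergeticSolution T E D q₀ v ∧
    (∀ t ∈ Icc 0 T,
      Tendsto (fun k => totalDiss D (interpolant (P k) (c k)) t) atTop (𝓝 (totalDiss D v t)) ∧
      Tendsto (fun k => E (interpolant (P k) (c k) t) t) atTop (𝓝 (E (v t) t))) ∧
    Tendsto (fun k => ∫ t in (0 : ℝ)..T,
      |power T E (interpolant (P k) (c k) t) t - power T E (v t) t|) atTop (𝓝 0) := by
  have h0m : (0 : ℝ) ∈ Icc 0 T := left_mem_Icc.2 h.pos.le
  have hw : ∀ s ∈ Icc 0 T, w (v s) ≠ ⊤ := fun s hs => hc.ne_top _ (limit_mem hc hs)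
  have hwk : ∀ k, ∀ s ∈ Icc 0 T, w (interpolant (P k) (c k) s) ≠ ⊤ := fun k s hs =>
    hc.ne_top _ (interpolant_mem hc hs k)
  have hv0 : v 0 = q₀ := by
    refine tendsto_nhds_unique (hc.tendsto 0 h0m) (tendsto_const_nhds.congr fun k => ?_)
    rw [interpolant_eq, (P k).index_of_nonpos le_rfl, (hc.incremental k).1]
  have hg0 : 0 ≤ g 0 := ge_of_tendsto' (hc.tendsto_diss 0 h0m) fun k => ENNReal.toReal_nonneg
  have hdissle : ∀ t ∈ Icc 0 T, totalDiss D v t ≤ ENNReal.ofReal (g t) := fun t ht =>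
    (totalDiss_le_of_le hc.monotone fun a b ha hab hb =>
      diss_limit_le h hc ha hab (hb.trans ht.2)).trans (ENNReal.ofReal_le_ofReal (by linarith))
  have hfin : ∀ t ∈ Icc 0 T, totalDiss D v t < ⊤ := fun t ht =>
    (hdissle t ht).trans_lt ENNReal.ofReal_lt_top
  have hle : ∀ t ∈ Icc 0 T, (totalDiss D v t).toReal ≤ g t := fun t ht =>
    ENNReal.toReal_le_of_le_ofReal (hg0.trans (hc.monotone ht.1)) (hdissle t ht)
  have hup := fun t ht => energy_upper_estimate h hc (t := t) ht
  have hlow := fun t ht => energy_lower_estimate h hc (t := t) ht (hfin t ht).ne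
  rw [hv0] at hlow
  -- The upper and lower estimates together give `g ≤ Diss`, while lower semicontinuity of the
  -- dissipation gave `Diss ≤ g`.
  have hgeq : ∀ t ∈ Icc 0 T, g t = (totalDiss D v t).toReal := fun t ht => by
    linarith [hup t ht, hlow t ht, hle t ht]
  have hpow : ∀ s ∈ Icc 0 T, power T E (v s) s = p (v s) s := fun s hs => h.power_eq (hw s hs) hs
  have hintp : IntegrableOn (fun s => p (v s) s) (Icc 0 T) :=
    Integrable.of_bound (aestronglyMeasurable_limit h hc) M (ae_restrict_of_forall_mem measurableSet_Icc fun s hs => by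
        rw [Real.norm_eq_abs]; exact hc.power_le _ (limit_mem hc hs) s hs)
  refine ⟨⟨hv0, fun t ht => (stable_and_tendsto h hc ht).1, fun t ht => h.hasPowerAt (hw t ht) ht,
    hintp.congr_fun (fun s hs => (hpow s hs).symm) measurableSet_Icc, hfin, fun t ht => ?_⟩,
    fun t ht => ⟨?_, tendsto_energy h hc ht tendsto_const_nhds fun _ => ht⟩, ?_⟩
  · have h1 : ∫ s in (0 : ℝ)..t, power T E (v s) s = ∫ s in (0 : ℝ)..t, p (v s) s :=
      intervalIntegral.integral_congr fun s hs => by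
        rw [uIcc_of_le ht.1] at hs
        exact hpow s ⟨hs.1, hs.2.trans ht.2⟩
    rw [h1, hv0]
    linarith [hup t ht, hlow t ht, hle t ht]
  · have h1 := (ENNReal.continuous_ofReal.tendsto _).comp (hc.tendsto_diss t ht)
    rw [hgeq t ht, ENNReal.ofReal_toReal (hfin t ht).ne] at h1
    refine h1.congr fun k => ?_
    refine ENNReal.ofReal_toReal ?_
    rw [totalDiss_interpolant h.diss_self h.diss_triangle _ _ ht.1 ht.2]
    exact ENNReal.sum_ne_top.2 fun i _ => h.diss_ne_top _ _
  · have h1 : ∀ k, ∫ t in (0 : ℝ)..T,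
        |power T E (interpolant (P k) (c k) t) t - power T E (v t) t| =
        ∫ t in (0 : ℝ)..T, |p (interpolant (P k) (c k) t) t - p (v t) t| := fun k =>
      intervalIntegral.integral_congr fun s hs => by
        rw [uIcc_of_le h.pos.le] at hs
        simp only [hpow s hs, h.power_eq (hwk k s hs) hs]
    simp only [h1]
    have h2 : Tendsto (fun k => ∫ t in (0 : ℝ)..T,
        |p (interpolant (P k) (c k) t) t - p (v t) t|) atTop (𝓝 (∫ t in (0 : ℝ)..T, (0 : ℝ))) := by
      refine intervalIntegral.tendsto_integral_filter_of_dominated_convergence (fun _ => M + M)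
        (Eventually.of_forall fun k => ?_)
        (Eventually.of_forall fun k => Eventually.of_forall fun s hs => ?_)
        intervalIntegrable_const (Eventually.of_forall fun s hs => ?_)
      · rw [uIoc_of_le h.pos.le]
        exact ((h.aestronglyMeasurable_power (P k) (c k) Ioc_subset_Icc_self).sub
          ((aestronglyMeasurable_limit h hc).mono_measure
            (Measure.restrict_mono Ioc_subset_Icc_self le_rfl))).norm
      · rw [uIoc_of_le h.pos.le] at hs
        have hs' := Ioc_subset_Icc_self hs
        rw [Real.norm_eq_abs, abs_abs]
        exact (abs_sub _ _).trans (add_le_add (hc.power_le _ (interpolant_mem hc hs' k) _ hs')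
          (hc.power_le _ (limit_mem hc hs') _ hs'))
      · rw [uIoc_of_le h.pos.le] at hs
        have h3 := (h.continuous_power.tendsto (v s, s)).comp
          ((hc.tendsto s (Ioc_subset_Icc_self hs)).prodMk_nhds tendsto_const_nhds)
        simpa using (h3.sub (tendsto_const_nhds (x := p (v s) s))).abs
    simpa using h2

end

end IsEnergeticSystem

/-! ### Energetic systems: compactness of incremental solutions -/

namespace IsEnergeticSystem

variable {Q : Type*} [TopologicalSpace Q] [T2Space Q] [FirstCountableTopology Q]
  {T : ℝ} {e p : Q → ℝ → ℝ} {w : Q → ℝ≥0∞} {E : Q → ℝ → ℝ≥0∞} {D : Q → Q → ℝ≥0∞}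
  (h : IsEnergeticSystem T e p w E D) {q₀ : Q} (h0 : q₀ ∈ stableStates E D 0)

include h h0

omit [T2Space Q] [FirstCountableTopology Q] in
/-- Incremental solutions remain in a compact set of states on which the plastic energy is finite
and the power is bounded. -/
theorem exists_compact_bound : ∃ (K : Set Q) (M : ℝ), IsCompact K ∧ (∀ q ∈ K, w q ≠ ⊤) ∧ 0 ≤ M ∧
    (∀ q ∈ K, ∀ t ∈ Icc 0 T, |p q t| ≤ M) ∧
    ∀ (P : TimePartition T) (c : ℕ → Q), IsIncrementalSolution E D P q₀ c →
      ∀ i ≤ P.num, c i ∈ K := by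
  obtain ⟨C, hC0, hC⟩ := h.growth
  -- The Gronwall level reached by `w` is finite because a stable initial state has finite energy.
  have ha : ENNReal.ofReal (Real.exp (C * T)) * (E q₀ 0 + 1) ≠ ⊤ :=
    ENNReal.mul_ne_top ENNReal.ofReal_ne_top
      (ENNReal.add_ne_top.2 ⟨h0.1.ne, ENNReal.one_ne_top⟩)
  have hK := h.isCompact_sublevel' ha
  obtain ⟨M, hM⟩ := (hK.prod (isCompact_Icc (a := (0 : ℝ)) (b := T))).exists_bound_of_continuousOn
    h.continuous_power.continuousOn
  refine ⟨_, max M 0, hK, fun q hq => (lt_of_le_of_lt hq ha.lt_top).ne, le_max_right _ _,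
    fun q hq t ht => ?_, fun P c hc i hi => h.plastic_incremental_le hc hC0 hC hi⟩
  exact (hM (q, t) ⟨hq, ht⟩).trans (le_max_left _ _)

omit [T2Space Q] in
/-- Every sequence of incremental solutions with vanishing time step has a convergent
subsequence. -/
theorem exists_isConvergent {P : ℕ → TimePartition T} {c : ℕ → ℕ → Q}
    (hstep : Tendsto (fun k => (P k).step) atTop (𝓝 0))
    (hc : ∀ k, IsIncrementalSolution E D (P k) q₀ (c k)) :
    ∃ (φ : ℕ → ℕ) (K : Set Q) (M : ℝ) (g : ℝ → ℝ) (v : ℝ → Q), StrictMono φ ∧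
      IsConvergent p w E D K M q₀ (fun k => P (φ k)) (fun k => c (φ k)) g v := by
  obtain ⟨K, M, hK, hKw, hM0, hM, hcK⟩ := h.exists_compact_bound h0
  have hproj : ∀ t, (projIcc 0 T h.pos.le t : ℝ) ∈ Icc 0 T := fun t => (projIcc 0 T h.pos.le t).2
  have hprojeq : ∀ t ∈ Icc 0 T, (projIcc 0 T h.pos.le t : ℝ) = t := fun t ht => by
    rw [projIcc_of_mem h.pos.le ht]
  have hdiss : ∀ k, ∀ t ∈ Icc 0 T, totalDiss D (interpolant (P k) (c k)) t =
      ∑ i ∈ Finset.range ((P k).index t), D (c k i) (c k (i + 1)) := fun k t ht =>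
    totalDiss_interpolant h.diss_self h.diss_triangle _ _ ht.1 ht.2
  have hne : ∀ k (s : Finset ℕ), ∑ i ∈ s, D (c k i) (c k (i + 1)) ≠ ⊤ := fun k s =>
    ENNReal.sum_ne_top.2 fun i _ => h.diss_ne_top _ _
  -- Projection onto `[0, T]` extends the dissipations to monotone functions on the whole line, as
  -- the selection principle requires.
  let f : ℕ → ℝ → ℝ := fun k t =>
    (totalDiss D (interpolant (P k) (c k)) (projIcc 0 T h.pos.le t)).toReal
  have hfmono : ∀ k, Monotone (f k) := fun k s t hst => by
    simp only [f]
    rw [hdiss k _ (hproj s), hdiss k _ (hproj t)]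
    exact ENNReal.toReal_mono (hne _ _) (Finset.sum_le_sum_of_subset (Finset.range_mono
      ((P k).index_mono (monotone_projIcc h.pos.le hst) (hproj t).2)))
  have hfab : ∀ k t, f k t ∈ Icc 0 ((E q₀ 0).toReal + M * T) := fun k t => by
    refine ⟨ENNReal.toReal_nonneg, ?_⟩
    simp only [f]
    have hidx := (P k).index_le (hproj t).2
    have h1 := h.incremental_energy_estimate (hc k) (fun i hi => hKw _ (hcK _ _ (hc k) i hi)) hidx
    rw [hdiss k _ (hproj t)]
    have h2 : ∀ j ≤ (P k).num, ∑ i ∈ Finset.range j,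
        ∫ s in (P k).node i..(P k).node (i + 1), p (c k i) s ≤ M * (P k).node j := by
      intro j
      induction j with
      | zero => intro _; simp [(P k).node_zero]
      | succ j ih =>
        intro hj
        have hlt := (P k).node_lt j hj
        have h3 := intervalIntegral.norm_integral_le_of_norm_le_const (C := M) (f := p (c k j))
          (a := (P k).node j) (b := (P k).node (j + 1)) fun s hs => by
            rw [uIoc_of_le hlt.le] at hs
            exact hM _ (hcK _ _ (hc k) j (by omega)) s
              ⟨((P k).node_nonneg (by omega)).trans hs.1.le, hs.2.trans ((P k).node_le hj)⟩
        rw [abs_of_pos (sub_pos.2 hlt)] at h3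
        have h4 := (le_abs_self _).trans h3
        rw [Finset.sum_range_succ]
        linarith [ih (by omega)]
    have h3 := h2 _ hidx
    have h4 := mul_le_mul_of_nonneg_left ((P k).node_le hidx) hM0
    have h5 : 0 ≤ (E (c k ((P k).index (projIcc 0 T h.pos.le t)))
      ((P k).node ((P k).index (projIcc 0 T h.pos.le t)))).toReal := ENNReal.toReal_nonneg
    linarith
  obtain ⟨φ, g, v, hφ, hg, hfg, huv⟩ := exists_subseq_tendsto_of_variation_le hK h.continuous_diss
    h.eq_of_diss_eq_zero f hfmono hfab
    (fun k t => interpolant (P k) (c k) (projIcc 0 T h.pos.le t))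
    (fun k t => hcK _ _ (hc k) _ ((P k).index_le (hproj t).2))
    (fun k s t hst => h.diss_interpolant_le (hproj s).1 (monotone_projIcc h.pos.le hst)
      (hproj t).2 k)
  refine ⟨φ, K, M, g, v, hφ, hK, hKw, hM, h0, hstep.comp hφ.tendsto_atTop, fun k => hc _,
    fun k => hcK _ _ (hc _), hg, fun t ht => ?_, fun t ht => ?_⟩
  · simpa only [f, hprojeq t ht] using hfg t
  · simpa only [hprojeq t ht] using huv t

omit [T2Space Q] [FirstCountableTopology Q] in
theorem incremental_hasPowerAt {P : TimePartition T} {c : ℕ → Q}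
    (hc : IsIncrementalSolution E D P q₀ c) :
    (∀ t ∈ Icc 0 T, HasPowerAt T E (interpolant P c t) t) ∧
      IntegrableOn (fun t => power T E (interpolant P c t) t) (Icc 0 T) := by
  obtain ⟨K, M, hK, hKw, hM0, hM, hcK⟩ := h.exists_compact_bound h0
  have hmem : ∀ t ∈ Icc 0 T, interpolant P c t ∈ K := fun t ht =>
    hcK _ _ hc _ (P.index_le ht.2)
  refine ⟨fun t ht => h.hasPowerAt (hKw _ (hmem t ht)) ht, ?_⟩
  have hint : IntegrableOn (fun t => p (interpolant P c t) t) (Icc 0 T) :=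
    Integrable.of_bound (h.aestronglyMeasurable_power P c subset_rfl) M
      (ae_restrict_of_forall_mem measurableSet_Icc fun t ht => hM _ (hmem t ht) t ht)
  exact hint.congr_fun (fun t ht => (h.power_eq (hKw _ (hmem t ht)) ht).symm) measurableSet_Icc

end IsEnergeticSystem

/-! ### Finite plasticity as an energetic system -/

theorem isEnergeticSystem {We : Tensor → ℝ}
    (hWe_nonneg : ∀ F ∈ GLpos, 0 ≤ We F) (hWe_smooth : ContDiffOn ℝ 1 We GLpos)
    (hWe_iso : ∀ F ∈ GLpos, ∀ R ∈ SO, We (F * R) = We F) {Wp : Tensor → ℝ≥0∞}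
    {r : ℝ} (hr : 0 < r) {T : ℝ} (hT : 0 < T) {c₂ : ℝ}
    (hKirchhoff : ∀ F ∈ GLpos, ‖F.transpose * tensorGrad We F‖ ≤ c₂ * (1 + We F))
    (hWp_compact : ∀ lam : ℝ, IsCompact {Cp : SLsymPos | WpHat Wp Cp ≤ ENNReal.ofReal lam})
    {C : ℝ → Tensor} (hC_pos : ∀ t ∈ Icc 0 T, (C t).PosDef)
    (hC_smooth : ContDiffOn ℝ 1 C (Icc 0 T)) :
    IsEnergeticSystem T (elasticEnergy We C hT.le) (elasticPower We C hT.le) (WpHat Wp)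
      (energy We Wp C) (dissip r) where
  pos := hT
  energy_eq A _ ht := energy_eq hT.le hWe_iso Wp hC_pos A ht
  nonneg := elasticEnergy_nonneg hT.le hWe_nonneg hC_pos
  continuous_energy := continuous_elasticEnergy hT.le hWe_smooth hC_pos hC_smooth
  continuous_power := continuous_elasticPower hT.le hT hWe_smooth hC_pos hC_smooth
  hasDerivWithinAt A _ ht := hasDerivWithinAt_elasticEnergy hT.le hWe_smooth hC_pos hC_smooth A ht
  growth := by
    obtain ⟨c, hc⟩ := exists_abs_elasticPower_le hT.le hT hKirchhoff hC_pos hC_smooth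
    -- A nonnegative constant makes the Gronwall factor at least `1`, so that it also dominates the
    -- time-independent part `w`.
    refine ⟨max c 0, le_max_right _ _, fun A t => (hc A t).trans ?_⟩
    exact mul_le_mul_of_nonneg_right (le_max_left _ _)
      (add_nonneg zero_le_one (elasticEnergy_nonneg hT.le hWe_nonneg hC_pos A t))
  isCompact_sublevel := hWp_compact
  diss_self := dissip_self
  diss_triangle := dissip_triangle
  diss_ne_top := dissip_ne_top hr.le
  continuous_diss := continuous_dissip hr.le
  eq_of_diss_eq_zero _ _ := eq_of_dissip_eq_zero hr

end FinitePlasticity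

theorem theorem4p1
    -- the elastic energy density: nonnegative, `C¹`, frame indifferent and isotropic on `GL⁺`
    (We : Tensor → ℝ)
    (hWe_nonneg : ∀ F ∈ GLpos, 0 ≤ We F)
    (hWe_smooth : ContDiffOn ℝ 1 We GLpos)
    (hWe_frame : ∀ F ∈ GLpos, ∀ R ∈ SO, We (R * F) = We F)
    (hWe_iso : ∀ F ∈ GLpos, ∀ R ∈ SO, We (F * R) = We F)
    -- the plastic energy density: indifferent to plastic rotations on `SL`
    (Wp : Tensor → ℝ≥0∞)
    (hWp_inv : ∀ P ∈ SL, ∀ R ∈ SO, Wp (R * P) = Wp P)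
    -- the yield threshold and the final time
    (r : ℝ) (hr : 0 < r) (T : ℝ) (hT : 0 < T)
    -- control of the Kirchhoff stress
    (c₂ : ℝ) (hc₂ : 0 < c₂)
    (hKirchhoff : ∀ F ∈ GLpos,
      ‖F.transpose * tensorGrad We F‖ ≤ c₂ * (1 + We F))
    -- compact sublevels of the plastic energy
    (hWp_compact : ∀ lam : ℝ, IsCompact
      {Cp : SLsymPos | WpHat Wp Cp ≤ ENNReal.ofReal lam})
    -- the deformation history
    (C : ℝ → Tensor)
    (hC_pos : ∀ t ∈ Icc 0 T, (C t).PosDef)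
    (hC_smooth : ContDiffOn ℝ 1 C (Icc 0 T))
    -- the stable initial state
    (Cp₀ : SLsymPos)
    (hCp₀ : Cp₀ ∈ stableStates (energy We Wp C)
      (dissip r) 0) :
    let E := energy We Wp C
    let D := dissip r
    -- an energetic solution exists
    (∃ Cp : ℝ → SLsymPos,
      IsEnergeticSolution T E D Cp₀ Cp) ∧
    -- the incremental minimization problems are solvable on every partition
    (∀ P : TimePartition T, ∃ c : ℕ → SLsymPos,
      IsIncrementalSolution E D P Cp₀ c) ∧
    -- as the time step vanishes, a subsequence of the interpolants converges to a solution
    (∀ (P : ℕ → TimePartition T) (c : ℕ → ℕ → SLsymPos),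
      Tendsto (fun k => (P k).step) atTop (𝓝 0) →
      (∀ k, IsIncrementalSolution E D (P k) Cp₀ (c k)) →
      (∀ k, ∀ t ∈ Icc 0 T,
        HasPowerAt T E (interpolant (P k) (c k) t) t) ∧
      (∀ k, IntegrableOn
        (fun t => power T E (interpolant (P k) (c k) t) t)
        (Icc 0 T)) ∧
      ∃ (φ : ℕ → ℕ) (Cp : ℝ → SLsymPos),
        StrictMono φ ∧
        IsEnergeticSolution T E D Cp₀ Cp ∧
        (∀ t ∈ Icc 0 T,
          Tendsto (fun k => interpolant (P (φ k)) (c (φ k)) t)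
            atTop (𝓝 (Cp t)) ∧
          Tendsto (fun k => totalDiss D
              (interpolant (P (φ k)) (c (φ k))) t)
            atTop (𝓝 (totalDiss D Cp t)) ∧
          Tendsto (fun k => E (interpolant (P (φ k)) (c (φ k)) t) t)
            atTop (𝓝 (E (Cp t) t))) ∧
        Tendsto (fun k => ∫ t in (0 : ℝ)..T,
            |power T E (interpolant (P (φ k)) (c (φ k)) t) t -
              power T E (Cp t) t|)
          atTop (𝓝 0)) := by
  intro E D
  have h := isEnergeticSystem hWe_nonneg hWe_smooth hWe_iso hr hT hKirchhoff hWp_compact hC_pos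
    hC_smooth
  refine ⟨?_, fun P => h.exists_incrementalSolution P Cp₀, fun P c hstep hc =>
    ⟨fun k => (h.incremental_hasPowerAt hCp₀ (hc k)).1,
      fun k => (h.incremental_hasPowerAt hCp₀ (hc k)).2, ?_⟩⟩
  -- Existence is the convergence statement applied to incremental solutions on uniform partitions.
  · choose c hc using fun n =>
      h.exists_incrementalSolution (TimePartition.uniform hT n) Cp₀
    obtain ⟨φ, K, M, g, v, -, hconv⟩ :=
      h.exists_isConvergent hCp₀ (TimePartition.tendsto_step_uniform hT) hc
    exact ⟨v, (h.limit_isEnergeticSolution hconv).1⟩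
  · obtain ⟨φ, K, M, g, v, hφ, hconv⟩ := h.exists_isConvergent hCp₀ hstep hc
    obtain ⟨hsol, hlim, hL1⟩ := h.limit_isEnergeticSolution hconv
    exact ⟨φ, v, hφ, hsol, fun t ht => ⟨hconv.tendsto t ht, hlim t ht⟩, hL1⟩
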